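/- An instance of uniform 2-dimensional vector multiple knapsack (2VMK) is a tuple $\mathcal I=(I,w,p,m)$, where $I$ is a finite set of items, $w:I\to[0,1]^2$ assigns to each item a 2-dimensional weight, $p:I\to\mathbb R_{\ge 0}$ assigns to each item a profit, and $m$ is the number of bins. A solution is a tuple of sets $S_1,\dots,S_m\subseteq I$ (not necessarily disjoint) such that $\sum_{i\in S_b}w(i)\le(1,1)$ coordinatewise for every $b\in\{1,\dots,m\}$; its profit is $\sum_{i\in S_1\cup\dots\cup S_m}p(i)$, and $\mathrm{OPT}(\mathcal I)$ is the maximum profit of a solution of $\mathcal I$. As usual for algorithmic statements, the weights and profits in an input are rational numbers and the input is encoded in binary; running times are measured on a random access machine with logarithmic cost, in terms of the length of the encoding. **Lemma.** Let $M>0$ be a constant integer. Then 2VMK restricted to the instances with $m\le M$ bins admits a polynomial-time approximation scheme: for every fixed $\varepsilon>0$ there are a deterministic algorithm $A_\varepsilon$ and a polynomial $q_\varepsilon$ (both may depend on $\varepsilon$ and $M$) such that, on every 2VMK instance $\mathcal I=(I,w,p,m)$ with $m\le M$, $A_\varepsilon$ returns, in time at most $q_\varepsilon(|\mathcal I|)$,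 where $|\mathcal I|$ is the length of the encoding of $\mathcal I$, a solution of profit at least $(1-\varepsilon)\cdot\mathrm{OPT}(\mathcal I)$. -/

import Mathlib

/-! ### A random access machine with logarithmic cost -/

namespace RAM

/-- The arithmetic operations of the machine on natural numbers: addition, truncated subtraction,
multiplication, and division rounded down (with `x / 0 = 0`). -/
inductive Op where
  | add
  | sub
  | mul
  | div

/-- The value of an arithmetic operation. -/
def Op.eval : Op → ℕ → ℕ → ℕ
  | Op.add, x, y => x + y
  | Op.sub, x, y => x - y
  | Op.mul, x, y => x * y
  | Op.div, x, y => x / y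

/-- A machine state: registers, addressed by the program text only, and a memory, addressed by
computed values. Every register and every memory cell holds a natural number. -/
structure State where
  reg : ℕ → ℕ
  mem : ℕ → ℕ

/-- Expressions: numerals, registers, memory cells with a computed address, and arithmetic. -/
inductive Expr where
  | const (c : ℕ)
  | reg (r : ℕ)
  | mem (addr : Expr)
  | bin (op : Op) (e₁ e₂ : Expr)

/-- The value of an expression. -/
def Expr.eval (s : State) : Expr → ℕ
  | Expr.const c => c
  | Expr.reg r => s.reg r
  | Expr.mem addr => s.mem (addr.eval s)
  | Expr.bin op e₁ e₂ => op.eval (e₁.eval s) (e₂.eval s)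

/-- The logarithmic cost of evaluating an expression: each node of the expression is charged
one unit plus the bit length of its value. (Operands and addresses are nodes of their own, so that
an operation is charged for the bit lengths of its operands, of its result and of the addresses it
uses.) -/
def Expr.cost (s : State) : Expr → ℕ
  | Expr.const c => 1 + Nat.size c
  | Expr.reg r => 1 + Nat.size (s.reg r)
  | Expr.mem addr => addr.cost s + (1 + Nat.size (s.mem (addr.eval s)))
  | Expr.bin op e₁ e₂ =>
      e₁.cost s + e₂.cost s + (1 + Nat.size (op.eval (e₁.eval s) (e₂.eval s)))

/-- Programs of the machine. A test succeeds when the value of its expression is not `0`. -/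
inductive Program where
  | skip
  | assign (r : ℕ) (e : Expr)
  | store (addr e : Expr)
  | seq (P Q : Program)
  | ite (e : Expr) (P Q : Program)
  | loop (e : Expr) (P : Program)

/-- `Exec P s s' t`: started in the state `s`, the program `P` halts in the state `s'`, and the
total logarithmic cost of the run is `t`. -/
inductive Exec : Program → State → State → ℕ → Prop where
  | skip (s : State) : Exec Program.skip s s 1
  | assign (r : ℕ) (e : Expr) (s : State) :
      Exec (Program.assign r e) s
        { reg := Function.update s.reg r (e.eval s), mem := s.mem }
        (1 + e.cost s)
  | store (addr e : Expr) (s : State) :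
      Exec (Program.store addr e) s
        { reg := s.reg, mem := Function.update s.mem (addr.eval s) (e.eval s) }
        (1 + addr.cost s + e.cost s)
  | seq {P Q : Program} {s s' s'' : State} {t t' : ℕ}
      (hP : Exec P s s' t) (hQ : Exec Q s' s'' t') :
      Exec (Program.seq P Q) s s'' (t + t')
  | ite_true {e : Expr} {P Q : Program} {s s' : State} {t : ℕ}
      (he : e.eval s ≠ 0) (hP : Exec P s s' t) :
      Exec (Program.ite e P Q) s s' (1 + e.cost s + t)
  | ite_false {e : Expr} {P Q : Program} {s s' : State} {t : ℕ}
      (he : e.eval s = 0) (hQ : Exec Q s s' t) :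
      Exec (Program.ite e P Q) s s' (1 + e.cost s + t)
  | loop_true {e : Expr} {P : Program} {s s' s'' : State} {t t' : ℕ}
      (he : e.eval s ≠ 0) (hP : Exec P s s' t) (hL : Exec (Program.loop e P) s' s'' t') :
      Exec (Program.loop e P) s s'' (1 + e.cost s + t + t')
  | loop_false {e : Expr} {P : Program} {s : State} (he : e.eval s = 0) :
      Exec (Program.loop e P) s s (1 + e.cost s)

/-- The initial state for the input `x`: the entries of `x` are in the memory cells
`0, 1, …, x.length - 1`, the length of `x` is in register `0`, and all else is `0`. -/
def State.init (x : List ℕ) : State where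
  reg := fun r => if r = 0 then x.length else 0
  mem := fun a => x.getD a 0

/-- The output held by a final state: register `0` holds its length, and its entries are in the
memory cells `0, 1, …`. -/
def State.output (s : State) : List ℕ :=
  (List.range (s.reg 0)).map s.mem

/-- The binary length of a list of natural numbers (one unit per entry plus its bit length). -/
def bitLength (x : List ℕ) : ℕ :=
  (x.map fun a => 1 + Nat.size a).sum

/-- On input `x`, the program `P` halts with output `y` after a run of cost at most `T`. -/
def Program.OutputsInTime (P : Program) (x y : List ℕ) (T : ℕ) : Prop :=
  ∃ (s : State) (t : ℕ), Exec P (State.init x) s t ∧ s.output = y ∧ t ≤ T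

end RAM

/-! ### Uniform 2-dimensional vector multiple knapsack -/

/-- An instance `(I, w, p, m)` of 2VMK, with items `I = {0, …, n - 1}`, weights `w i ∈ [0,1]²`,
profits `p i ≥ 0` and `m` bins. As inputs of algorithms, the weights and profits are rational. -/
structure VMK where
  n : ℕ
  w : Fin n → Fin 2 → ℚ
  w_nonneg : ∀ i j, 0 ≤ w i j
  w_le_one : ∀ i j, w i j ≤ 1
  p : Fin n → ℚ
  p_nonneg : ∀ i, 0 ≤ p i
  m : ℕ

namespace VMK

/-- `S_1, …, S_m ⊆ I` is a solution if `w(S_b) ≤ (1,1)` for each bin `b`. -/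
def IsSolution (I : VMK) (S : Fin I.m → Finset (Fin I.n)) : Prop :=
  ∀ b j, ∑ i ∈ S b, I.w i j ≤ 1

/-- The profit `p(⋃_b S_b)`: a selected item counts once, even if it is in several bins. -/
def profit (I : VMK) (S : Fin I.m → Finset (Fin I.n)) : ℚ :=
  ∑ i ∈ Finset.univ.biUnion S, I.p i

open Classical in
/-- The optimal profit: the maximum over the finite, nonempty set of solutions. -/
noncomputable def opt (I : VMK) : ℚ :=
  (Finset.univ.filter I.IsSolution).sup'
    ⟨fun _ => ∅, by simp [IsSolution]⟩ I.profit

/-- The encoding of an instance: `n`, `m`, and for each item the numerators and denominators (in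
lowest terms) of its two weights and of its profit. -/
def encode (I : VMK) : List ℕ :=
  [I.n, I.m] ++ (List.finRange I.n).flatMap fun i =>
    [(I.w i 0).num.natAbs, (I.w i 0).den, (I.w i 1).num.natAbs, (I.w i 1).den,
      (I.p i).num.natAbs, (I.p i).den]

/-- The encoding of `S_1, …, S_m`: for each bin in turn, the `0`-`1` indicator of its items. -/
def encodeBins (I : VMK) (S : Fin I.m → Finset (Fin I.n)) : List ℕ :=
  (List.finRange I.m).flatMap fun b =>
    (List.finRange I.n).map fun i => if i ∈ S b then 1 else 0

/-- `P` is a (polynomial-time, deterministic) `α`-approximation algorithm for the instances of 2VMK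
in the class `C`: for some polynomial `q`, on each instance `I ∈ C` it outputs, within time `q` of
the length of the encoding of `I`, a solution of profit at least `α · OPT(I)`. -/
def IsApproxAlgorithm (C : Set VMK) (α : ℝ) (P : RAM.Program) : Prop :=
  ∃ q : Polynomial ℕ, ∀ I ∈ C, ∃ S : Fin I.m → Finset (Fin I.n),
    I.IsSolution S ∧ α * (I.opt : ℝ) ≤ (I.profit S : ℝ) ∧
      P.OutputsInTime I.encode (I.encodeBins S) (q.eval (RAM.bitLength I.encode))

/-- The instances in `C` admit a PTAS: there is a family `(A ε)` such that `A ε` is a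
`(1 - ε)`-approximation algorithm for them, for each `ε > 0`. -/
def AdmitsPTAS (C : Set VMK) : Prop :=
  ∃ A : ℝ → RAM.Program, ∀ ε : ℝ, 0 < ε → IsApproxAlgorithm C (1 - ε) (A ε)

end VMK

namespace RAM

/-! ### Bit lengths -/

/-! Fix an integer K > 2M/ε and clear denominators, so that every bin has the integer capacity `den`
in both dimensions. In an optimal solution of profit P, at most K items have profit above P/K. The
algorithm tries all placements of at most K items; there are polynomially many, as K is constant,
and one of them is the placement of these valuable items. Let c be the capacity which that guess
leaves in some bin and dimension. Each remaining item has profit at most P/K, and removing a set of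
profit at most P/K brings the remaining load down to 2K/(2K+1) · c (`exists_removal`). Doing this
for all 2m pairs of a bin and a dimension loses at most 2mP/K ≤ εP (`near_optimal`).

The slack gained pays for rounding. Measured in units of (c+1)/(n(2K+1)) and rounded down, loads
within the budget 2Kn are truly feasible (`extraLoad_le`), while the thinned optimum is within that
budget (`rload_le`). As m ≤ M, there are only polynomially many vectors of rounded budgets, and a
dynamic program over the items finds a most profitable extension of the guess with respect to
rounded loads (`table_spec`).

For the running time, the functions satisfying `PT` are closed under arithmetic, input access and
bounded iteration (`PT.iter`). Their programs use registers only and leave the input in memory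
intact; therefore assignments, the table of the dynamic program and the output are packed as digits
of single numbers, and memory is written only at the very end (`exists_program`). -/

theorem size_add_le (x y : ℕ) : Nat.size (x + y) ≤ Nat.size x + Nat.size y + 1 := by
  rw [Nat.size_le]
  have hx := Nat.lt_size_self x
  have hy := Nat.lt_size_self y
  have h1 : 2 ^ Nat.size x ≤ 2 ^ (Nat.size x + Nat.size y) :=
    Nat.pow_le_pow_right (by norm_num) (by omega)
  have h2 : 2 ^ Nat.size y ≤ 2 ^ (Nat.size x + Nat.size y) :=
    Nat.pow_le_pow_right (by norm_num) (by omega)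
  rw [pow_succ]
  omega

theorem size_mul_le (x y : ℕ) : Nat.size (x * y) ≤ Nat.size x + Nat.size y := by
  rw [Nat.size_le, pow_add]
  exact Nat.mul_lt_mul'' (Nat.lt_size_self x) (Nat.lt_size_self y)

theorem size_le_self (x : ℕ) : Nat.size x ≤ x := by
  rw [Nat.size_le]
  exact Nat.lt_two_pow_self

theorem size_op_le (o : Op) (x y : ℕ) : Nat.size (o.eval x y) ≤ Nat.size x + Nat.size y + 1 := by
  cases o
  · exact size_add_le x y
  · exact (Nat.size_le_size (Nat.sub_le x y)).trans (by omega)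
  · exact (size_mul_le x y).trans (by omega)
  · exact (Nat.size_le_size (Nat.div_le_self x y)).trans (by omega)

theorem size_pow_le (x e : ℕ) : Nat.size (x ^ e) ≤ e * Nat.size x + 1 := by
  induction e with
  | zero => simp
  | succ e ih =>
    rw [pow_succ]
    have := size_mul_le (x ^ e) x
    have h : (e + 1) * Nat.size x = e * Nat.size x + Nat.size x := by ring
    omega

theorem size_getD_le (x : List ℕ) (i : ℕ) : Nat.size (x.getD i 0) ≤ bitLength x := by
  by_cases h : i < x.length
  · rw [List.getD_eq_getElem _ _ h]
    have := List.single_le_sum (l := x.map fun a => 1 + Nat.size a) (by simp)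
      (1 + Nat.size x[i]) (List.mem_map_of_mem (List.getElem_mem h))
    unfold bitLength
    omega
  · rw [List.getD_eq_default _ _ (not_lt.mp h)]
    simp

/-! ### Contexts -/

/-- Types of inputs with an encoding. -/
class Input (ι : Type) where
  enc : ι → List ℕ

/-- A context: an input together with finitely many numbers, held in registers. -/
class Ctx (ι : outParam Type) [Input ι] (α : Type) where
  base : α → ι
  size : α → ℕ
  Place : Type
  Below : Place → ℕ → Prop
  Holds : Place → α → (ℕ → ℕ) → Prop
  bitLength_le : ∀ a, bitLength (Input.enc (base a)) ≤ size a
  below_mono : ∀ {π d d'}, Below π d → d ≤ d' → Below π d'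
  holds_congr : ∀ {π d a r r'}, Below π d → (∀ i < d, r' i = r i) → Holds π a r → Holds π a r'

/-- A natural number whose bit length (rather than its value) is counted. -/
structure Big where
  val : ℕ

variable {ι : Type} [Input ι]

instance Ctx.input : Ctx ι ι where
  base := id
  size a := bitLength (Input.enc a)
  Place := Unit
  Below _ _ := True
  Holds _ _ _ := True
  bitLength_le _ := le_rfl
  below_mono _ _ := trivial
  holds_congr _ _ _ := trivial

/-- For loop counters: the value itself enters the size, so a bound polynomial in the size may
depend on the counter. -/
instance Ctx.index {α : Type} [Ctx ι α] : Ctx ι (α × ℕ) where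
  base p := Ctx.base p.1
  size p := Ctx.size p.1 + p.2
  Place := Ctx.Place α × ℕ
  Below π d := Ctx.Below π.1 d ∧ π.2 < d
  Holds π p r := Ctx.Holds π.1 p.1 r ∧ r π.2 = p.2
  bitLength_le p := (Ctx.bitLength_le p.1).trans (Nat.le_add_right _ _)
  below_mono h hd := ⟨Ctx.below_mono h.1 hd, h.2.trans_le hd⟩
  holds_congr h hr hh := ⟨Ctx.holds_congr h.1 hr hh.1, (hr _ h.2).trans hh.2⟩

/-- For accumulators, whose values may be exponential: only the bit length enters the size. -/
instance Ctx.big {α : Type} [Ctx ι α] : Ctx ι (α × Big) where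
  base p := Ctx.base p.1
  size p := Ctx.size p.1 + Nat.size p.2.val
  Place := Ctx.Place α × ℕ
  Below π d := Ctx.Below π.1 d ∧ π.2 < d
  Holds π p r := Ctx.Holds π.1 p.1 r ∧ r π.2 = p.2.val
  bitLength_le p := (Ctx.bitLength_le p.1).trans (Nat.le_add_right _ _)
  below_mono h hd := ⟨Ctx.below_mono h.1 hd, h.2.trans_le hd⟩
  holds_congr h hr hh := ⟨Ctx.holds_congr h.1 hr hh.1, (hr _ h.2).trans hh.2⟩

variable {α : Type} [Ctx ι α]

/-! ### Polynomially bounded functions -/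

/-- `f` is bounded by a polynomial in the size of the context. -/
def PB (f : α → ℕ) : Prop := ∃ c, ∀ a, f a ≤ (Ctx.size a + 2) ^ c

namespace PB

variable {f g : α → ℕ}

theorem mono (hg : PB g) (h : ∀ a, f a ≤ g a) : PB f :=
  hg.imp fun _ hc a => (h a).trans (hc a)

theorem size : PB (fun a : α => Ctx.size a) := ⟨1, fun a => by simp⟩

theorem const (n : ℕ) : PB (fun _ : α => n) :=
  ⟨n, fun a => (Nat.lt_two_pow_self (n := n)).le.trans (Nat.pow_le_pow_left (by omega) n)⟩

theorem mul (hf : PB f) (hg : PB g) : PB (fun a => f a * g a) := by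
  obtain ⟨c, hc⟩ := hf
  obtain ⟨e, he⟩ := hg
  exact ⟨c + e, fun a => by rw [pow_add]; exact Nat.mul_le_mul (hc a) (he a)⟩

theorem add (hf : PB f) (hg : PB g) : PB (fun a => f a + g a) := by
  obtain ⟨c, hc⟩ := hf
  obtain ⟨e, he⟩ := hg
  refine ⟨max c e + 1, fun a => ?_⟩
  have h1 : (Ctx.size a + 2) ^ c ≤ (Ctx.size a + 2) ^ max c e :=
    Nat.pow_le_pow_right (by omega) (le_max_left _ _)
  have h2 : (Ctx.size a + 2) ^ e ≤ (Ctx.size a + 2) ^ max c e :=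
    Nat.pow_le_pow_right (by omega) (le_max_right _ _)
  have h3 : (Ctx.size a + 2) ^ max c e * 2 ≤ (Ctx.size a + 2) ^ max c e * (Ctx.size a + 2) :=
    Nat.mul_le_mul_left _ (by omega)
  rw [pow_succ]
  linarith [hc a, he a]

theorem pow (hf : PB f) (k : ℕ) : PB (fun a => f a ^ k) := by
  induction k with
  | zero => simpa using const (α := α) 1
  | succ k ih => simpa only [pow_succ] using ih.mul hf

theorem fst (hf : PB f) : PB (fun p : α × ℕ => f p.1) := by
  obtain ⟨c, hc⟩ := hf
  exact ⟨c, fun p => (hc p.1).trans (Nat.pow_le_pow_left (Nat.add_le_add_right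
    (Nat.le_add_right _ _) _) c)⟩

theorem fst_big (hf : PB f) : PB (fun p : α × Big => f p.1) := by
  obtain ⟨c, hc⟩ := hf
  exact ⟨c, fun p => (hc p.1).trans (Nat.pow_le_pow_left (Nat.add_le_add_right
    (Nat.le_add_right _ _) _) c)⟩

theorem snd : PB (fun p : α × ℕ => p.2) :=
  ⟨1, fun p => by rw [pow_one]; exact (Nat.le_add_left _ (Ctx.size p.1)).trans (Nat.le_add_right _ 2)⟩

end PB

/-! ### Functions computed in polynomial time -/

/-- The memory that holds the input of a context. -/
def inputMem (a : α) : ℕ → ℕ := fun i => (Input.enc (Ctx.base a)).getD i 0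

/-- `P` computes `f` into the register `d`, keeping the memory and the registers below `d`. -/
def Computes (f : α → ℕ) (π : Ctx.Place α) (d : ℕ) (P : Program) (T : α → ℕ) : Prop :=
  ∀ a s, Ctx.Holds π a s.reg → s.mem = inputMem a →
    ∃ s' t, Exec P s s' t ∧ s'.mem = s.mem ∧ (∀ i < d, s'.reg i = s.reg i) ∧
      s'.reg d = f a ∧ t ≤ T a

/-- `f` can be computed in polynomial time. -/
structure PT (f : α → ℕ) : Prop where
  size : PB fun a => Nat.size (f a)
  exec : ∀ π d, Ctx.Below π d → ∃ P T, PB T ∧ Computes f π d P T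

/-- `p` can be decided in polynomial time. -/
def PTP (p : α → Prop) : Prop := ∃ f, PT f ∧ ∀ a, f a ≠ 0 ↔ p a

/-- Bounded iteration. -/
def iter (n : ℕ) (step : ℕ → ℕ → ℕ) (init : ℕ) : ℕ :=
  Nat.rec init step n

@[simp] theorem iter_zero (step : ℕ → ℕ → ℕ) (init : ℕ) : iter 0 step init = init := rfl

@[simp] theorem iter_succ (n : ℕ) (step : ℕ → ℕ → ℕ) (init : ℕ) :
    iter (n + 1) step init = step n (iter n step init) := rfl

namespace PT

variable {f g : α → ℕ}

theorem congr (hf : PT f) (h : ∀ a, f a = g a) : PT g := by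
  rwa [← funext h]

theorem const (n : ℕ) : PT (fun _ : α => n) where
  size := PB.const _
  exec π d _ := ⟨.assign d (.const n), fun _ => 1 + (1 + Nat.size n), PB.const _, fun a s _ _ =>
    ⟨_, _, Exec.assign _ _ _, rfl, fun i hi => by simp [hi.ne], by simp [Expr.eval], le_rfl⟩⟩

theorem snd : PT (fun p : α × ℕ => p.2) where
  size := PB.snd.mono fun p => size_le_self p.2
  exec π d _ := ⟨.assign d (.reg π.2), fun p => 1 + (1 + p.2),
    (PB.const 1).add ((PB.const 1).add PB.snd), fun a s hs _ =>
    ⟨_, _, Exec.assign _ _ _, rfl, fun i hi => by simp [hi.ne], by simp [Expr.eval, hs.2],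
      by simp [Expr.cost, hs.2, size_le_self]⟩⟩

theorem acc : PT (fun p : α × Big => p.2.val) where
  size := PB.size.mono fun p => Nat.le_add_left _ _
  exec π d _ := ⟨.assign d (.reg π.2), fun p => 1 + (1 + Ctx.size p),
    (PB.const 1).add ((PB.const 1).add PB.size), fun a s hs _ =>
    ⟨_, _, Exec.assign _ _ _, rfl, fun i hi => by simp [hi.ne], by simp [Expr.eval, hs.2],
      by
        have : Nat.size a.2.val ≤ Ctx.size a := Nat.le_add_left _ _
        simpa [Expr.cost, hs.2] using this⟩⟩

theorem fst (hf : PT f) : PT (fun p : α × ℕ => f p.1) where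
  size := hf.size.fst
  exec π d hd := by
    obtain ⟨P, T, hT, hP⟩ := hf.exec π.1 d hd.1
    exact ⟨P, fun p => T p.1, hT.fst, fun a s hs hm => hP a.1 s hs.1 hm⟩

theorem fst_big (hf : PT f) : PT (fun p : α × Big => f p.1) where
  size := hf.size.fst_big
  exec π d hd := by
    obtain ⟨P, T, hT, hP⟩ := hf.exec π.1 d hd.1
    exact ⟨P, fun p => T p.1, hT.fst_big, fun a s hs hm => hP a.1 s hs.1 hm⟩

theorem op (o : Op) (hf : PT f) (hg : PT g) : PT (fun a => o.eval (f a) (g a)) where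
  size := ((hf.size.add hg.size).add (PB.const 1)).mono fun a => size_op_le o _ _
  exec π d hd := by
    obtain ⟨P, T, hT, hP⟩ := hf.exec π d hd
    obtain ⟨P', T', hT', hP'⟩ := hg.exec π (d + 1) (Ctx.below_mono hd (Nat.le_succ d))
    refine ⟨.seq P (.seq P' (.assign d (.bin o (.reg d) (.reg (d + 1))))),
      fun a => T a + (T' a + (2 * Nat.size (f a) + 2 * Nat.size (g a) + 5)),
      hT.add (hT'.add ((((PB.const 2).mul hf.size).add ((PB.const 2).mul hg.size)).add
        (PB.const 5))), fun a s hs hm => ?_⟩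
    obtain ⟨s₁, t₁, h₁, m₁, r₁, v₁, c₁⟩ := hP a s hs hm
    obtain ⟨s₂, t₂, h₂, m₂, r₂, v₂, c₂⟩ :=
      hP' a s₁ (Ctx.holds_congr hd r₁ hs) (m₁.trans hm)
    have v₃ : s₂.reg d = f a := (r₂ d (Nat.lt_succ_self d)).trans v₁
    refine ⟨_, _, h₁.seq (h₂.seq (Exec.assign _ _ _)), m₂.trans m₁, fun i hi => ?_, ?_, ?_⟩
    · simp only [ne_eq, hi.ne, not_false_eq_true, Function.update_of_ne]
      exact (r₂ i (hi.trans (Nat.lt_succ_self d))).trans (r₁ i hi)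
    · simp [Expr.eval, v₂, v₃]
    · have := size_op_le o (f a) (g a)
      simp only [Expr.cost, Expr.eval, v₂, v₃]
      omega

theorem add (hf : PT f) (hg : PT g) : PT (fun a => f a + g a) := op .add hf hg
theorem sub (hf : PT f) (hg : PT g) : PT (fun a => f a - g a) := op .sub hf hg
theorem mul (hf : PT f) (hg : PT g) : PT (fun a => f a * g a) := op .mul hf hg
theorem div (hf : PT f) (hg : PT g) : PT (fun a => f a / g a) := op .div hf hg

theorem mod (hf : PT f) (hg : PT g) : PT (fun a => f a % g a) :=
  (hf.sub (hg.mul (hf.div hg))).congr fun a => by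
    have := Nat.mod_add_div (f a) (g a)
    omega

/-- Sound because computing `f` does not alter the memory, which therefore still holds the input. -/
theorem mem (hf : PT f) : PT (fun a => (Input.enc (Ctx.base a)).getD (f a) 0) where
  size := PB.size.mono fun a => (size_getD_le _ _).trans (Ctx.bitLength_le a)
  exec π d hd := by
    obtain ⟨P, T, hT, hP⟩ := hf.exec π d hd
    refine ⟨.seq P (.assign d (.mem (.reg d))),
      fun a => T a + (Nat.size (f a) + Ctx.size a + 3),
      hT.add ((hf.size.add PB.size).add (PB.const 3)), fun a s hs hm => ?_⟩
    obtain ⟨s₁, t₁, h₁, m₁, r₁, v₁, c₁⟩ := hP a s hs hm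
    refine ⟨_, _, h₁.seq (Exec.assign _ _ _), m₁, fun i hi => ?_, ?_, ?_⟩
    · simp only [ne_eq, hi.ne, not_false_eq_true, Function.update_of_ne]
      exact r₁ i hi
    · simp [Expr.eval, v₁, m₁, hm, inputMem]
    · have := (size_getD_le (Input.enc (Ctx.base a)) (f a)).trans (Ctx.bitLength_le a)
      simp only [Expr.cost, Expr.eval, v₁, m₁, hm, inputMem]
      omega

/-- Two bounds are needed: the number of rounds must be polynomial in value (`hnb`), and all
intermediate accumulators must have polynomial bit length (`hb`). The second does not follow from
the cost of one step, since repeated squaring doubles the length in every round. -/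
theorem iter {n init : α → ℕ} {step : α → ℕ → ℕ → ℕ} {A : α → ℕ} (hn : PT n) (hnb : PB n)
    (hinit : PT init) (hstep : PT fun p : (α × ℕ) × Big => step p.1.1 p.1.2 p.2.val) (hA : PB A)
    (hb : ∀ a k, k ≤ n a → Nat.size (RAM.iter k (step a) (init a)) ≤ A a) :
    PT fun a => RAM.iter (n a) (step a) (init a) where
  size := hA.mono fun a => hb a _ le_rfl
  exec π d hd := by
    obtain ⟨P₁, T₁, hT₁, hP₁⟩ := hinit.exec π d hd
    obtain ⟨P₂, T₂, hT₂, hP₂⟩ := hn.exec π (d + 1) (Ctx.below_mono hd (Nat.le_succ d))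
    -- Register `d` holds the accumulator, `d + 1` the number of rounds and `d + 2` the counter; the
    -- new accumulator is formed in `d + 3` and then copied to `d`.
    obtain ⟨P₃, T₃, ⟨c, hc⟩, hP₃⟩ := hstep.exec ((π, d + 2), d) (d + 3)
      ⟨⟨Ctx.below_mono hd (by omega), Nat.lt_succ_self _⟩, Nat.lt_add_of_pos_right (by omega)⟩
    let body := P₃.seq ((Program.assign d (.reg (d + 3))).seq
      (.assign (d + 2) (.bin .add (.reg (d + 2)) (.const 1))))
    let cond := Expr.bin .sub (.reg (d + 1)) (.reg (d + 2))
    let C : α → ℕ := fun a => (Ctx.size a + n a + A a + 2) ^ c + A a + 5 * n a + 20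
    have hC : PB C := ((((((PB.size.add hnb).add hA).add (PB.const 2)).pow c).add hA).add
      ((PB.const 5).mul hnb)).add (PB.const 20)
    have loop : ∀ a j k, k + j = n a → ∀ s : State, Ctx.Holds π a s.reg → s.mem = inputMem a →
        s.reg d = RAM.iter k (step a) (init a) → s.reg (d + 1) = n a → s.reg (d + 2) = k →
        ∃ s' t, Exec (.loop cond body) s s' t ∧ s'.mem = s.mem ∧ (∀ i < d, s'.reg i = s.reg i) ∧
          s'.reg d = RAM.iter (n a) (step a) (init a) ∧ t ≤ (j + 1) * C a := by
      intro a j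
      induction j with
      | zero =>
        intro k hk s _ _ h0 h1 h2
        have hk : k = n a := by omega
        subst hk
        refine ⟨s, _, Exec.loop_false (by simp [cond, Expr.eval, Op.eval, h1, h2]), rfl,
          fun _ _ => rfl, h0, ?_⟩
        have := size_le_self (n a)
        simp only [cond, Expr.cost, Expr.eval, Op.eval, h1, h2, C, Nat.sub_self, Nat.size_zero]
        omega
      | succ j ih =>
        intro k hk s hs hm h0 h1 h2
        obtain ⟨s₁, t₁, e₁, m₁, r₁, v₁, c₁⟩ := hP₃ ((a, k), ⟨RAM.iter k (step a) (init a)⟩) s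
          ⟨⟨hs, h2⟩, h0⟩ hm
        simp only at v₁
        have q0 : s₁.reg d = s.reg d := r₁ d (by omega)
        have q1 : s₁.reg (d + 1) = n a := (r₁ _ (by omega)).trans h1
        have q2 : s₁.reg (d + 2) = k := (r₁ _ (by omega)).trans h2
        have e₂ := Exec.assign d (.reg (d + 3)) s₁
        have e₃ := Exec.assign (d + 2) (.bin .add (.reg (d + 2)) (.const 1))
          { reg := Function.update s₁.reg d (Expr.eval s₁ (.reg (d + 3))), mem := s₁.mem }
        have eb : Exec body s _ _ := e₁.seq (e₂.seq e₃)
        have hlow : ∀ i < d, (Function.update (Function.update s₁.reg d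
            (Expr.eval s₁ (.reg (d + 3)))) (d + 2) (Expr.eval
            { reg := Function.update s₁.reg d (Expr.eval s₁ (.reg (d + 3))), mem := s₁.mem }
            (.bin .add (.reg (d + 2)) (.const 1)))) i = s.reg i := fun i hi => by
          rw [Function.update_of_ne (by omega), Function.update_of_ne (by omega)]
          exact r₁ i (by omega)
        obtain ⟨s', t', e', m', r', v', c'⟩ := ih (k + 1) (by omega)
          { reg := Function.update (Function.update s₁.reg d (Expr.eval s₁ (.reg (d + 3)))) (d + 2)
              (Expr.eval { reg := Function.update s₁.reg d (Expr.eval s₁ (.reg (d + 3))),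
                           mem := s₁.mem } (.bin .add (.reg (d + 2)) (.const 1))), mem := s₁.mem }
          (Ctx.holds_congr hd hlow hs) (m₁.trans hm)
          (by simp [Expr.eval, v₁])
          (by simp [q1])
          (by simp [Expr.eval, Op.eval, q2])
        refine ⟨s', _, Exec.loop_true (by simp [cond, Expr.eval, Op.eval, h1, h2]; omega) eb e',
          m'.trans m₁, fun i hi => (r' i hi).trans (hlow i hi), v', ?_⟩
        have b1 := hb a (k + 1) (by omega)
        rw [iter_succ] at b1
        have b0 := hb a k (by omega)
        have b2 : t₁ ≤ (Ctx.size a + n a + A a + 2) ^ c := by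
          refine (c₁.trans (hc _)).trans (Nat.pow_le_pow_left ?_ c)
          have : Ctx.size ((a, k), (⟨RAM.iter k (step a) (init a)⟩ : Big)) =
            Ctx.size a + k + Nat.size (RAM.iter k (step a) (init a)) := rfl
          omega
        have z1 := size_le_self (n a)
        have z2 := size_le_self k
        have z3 := size_le_self (n a - k)
        have z4 := size_le_self (k + 1)
        have z5 : (j + 1 + 1) * C a = C a + (j + 1) * C a := by ring
        rw [z5]
        refine le_trans ?_ (Nat.add_le_add_left c' _)
        refine Nat.add_le_add_right ?_ _
        simp only [cond, Expr.cost, Expr.eval, Op.eval, h1, h2, v₁, C, ne_eq,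
          Nat.add_eq_left, OfNat.ofNat_ne_zero, not_false_eq_true, Function.update_of_ne, q2,
          Nat.size_one]
        omega
    refine ⟨P₁.seq (P₂.seq ((Program.assign (d + 2) (.const 0)).seq (.loop cond body))),
      fun a => T₁ a + (T₂ a + (2 + (n a + 1) * C a)),
      hT₁.add (hT₂.add ((PB.const 2).add ((hnb.add (PB.const 1)).mul hC))), fun a s hs hm => ?_⟩
    obtain ⟨s₁, t₁, e₁, m₁, r₁, v₁, c₁⟩ := hP₁ a s hs hm
    obtain ⟨s₂, t₂, e₂, m₂, r₂, v₂, c₂⟩ := hP₂ a s₁ (Ctx.holds_congr hd r₁ hs) (m₁.trans hm)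
    have hlow : ∀ i < d, Function.update s₂.reg (d + 2) (Expr.eval s₂ (.const 0)) i = s.reg i :=
      fun i hi => by
        rw [Function.update_of_ne (by omega), r₂ i (by omega), r₁ i hi]
    obtain ⟨s', t', e', m', r', v', c'⟩ := loop a (n a) 0 (by omega)
      { reg := Function.update s₂.reg (d + 2) (Expr.eval s₂ (.const 0)), mem := s₂.mem }
      (Ctx.holds_congr hd hlow hs) (m₂.trans (m₁.trans hm))
      (by simp [r₂ d (Nat.lt_succ_self d), v₁]) (by simp [v₂]) (by simp [Expr.eval])
    refine ⟨s', _, e₁.seq (e₂.seq ((Exec.assign _ _ _).seq e')), m'.trans (m₂.trans m₁),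
      fun i hi => (r' i hi).trans (hlow i hi), v', ?_⟩
    simp only [Expr.cost, Nat.size_zero]
    omega

theorem sum {n : α → ℕ} {f : α → ℕ → ℕ} (hn : PT n) (hnb : PB n)
    (hf : PT fun p : α × ℕ => f p.1 p.2) :
    PT fun a => ∑ k ∈ Finset.range (n a), f a k := by
  obtain ⟨c, hc⟩ := hf.size
  have key : ∀ a k, RAM.iter k (fun k s => s + f a k) 0 = ∑ k ∈ Finset.range k, f a k := by
    intro a k
    induction k with
    | zero => rfl
    | succ k ih => rw [iter_succ, ih, Finset.sum_range_succ]
  refine (PT.iter (A := fun a => n a * ((Ctx.size a + n a + 2) ^ c + 1)) hn hnb (const 0)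
    (step := fun a k s => s + f a k) (acc.add hf.fst_big)
    (hnb.mul ((((PB.size.add hnb).add (PB.const 2)).pow c).add (PB.const 1)))
    fun a k hk => ?_).congr fun a => key a _
  rw [← Nat.add_zero (n a * _)]
  refine le_trans ?_ (Nat.add_le_add_right (Nat.mul_le_mul_right _ hk) _)
  induction k with
  | zero => simp
  | succ k ih =>
    rw [iter_succ]
    have h1 := ih (by omega)
    have h2 : Nat.size (f a k) ≤ (Ctx.size a + n a + 2) ^ c := by
      refine (hc (a, k)).trans (Nat.pow_le_pow_left ?_ c)
      have : Ctx.size (a, k) = Ctx.size a + k := rfl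
      omega
    have h3 := size_add_le (RAM.iter k (fun k s => s + f a k) 0) (f a k)
    rw [Nat.succ_mul]
    omega

theorem prod {n : α → ℕ} {f : α → ℕ → ℕ} (hn : PT n) (hnb : PB n)
    (hf : PT fun p : α × ℕ => f p.1 p.2) :
    PT fun a => ∏ k ∈ Finset.range (n a), f a k := by
  obtain ⟨c, hc⟩ := hf.size
  have key : ∀ a k, RAM.iter k (fun k s => s * f a k) 1 = ∏ k ∈ Finset.range k, f a k := by
    intro a k
    induction k with
    | zero => rfl
    | succ k ih => rw [iter_succ, ih, Finset.prod_range_succ]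
  refine (PT.iter (A := fun a => n a * (Ctx.size a + n a + 2) ^ c + 1) hn hnb (const 1)
    (step := fun a k s => s * f a k) (acc.mul hf.fst_big)
    ((hnb.mul (((PB.size.add hnb).add (PB.const 2)).pow c)).add (PB.const 1))
    fun a k hk => ?_).congr fun a => key a _
  refine le_trans ?_ (Nat.add_le_add_right (Nat.mul_le_mul_right _ hk) _)
  induction k with
  | zero => simp
  | succ k ih =>
    rw [iter_succ]
    have h1 := ih (by omega)
    have h2 : Nat.size (f a k) ≤ (Ctx.size a + n a + 2) ^ c := by
      refine (hc (a, k)).trans (Nat.pow_le_pow_left ?_ c)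
      have : Ctx.size (a, k) = Ctx.size a + k := rfl
      omega
    have h3 := size_mul_le (RAM.iter k (fun k s => s * f a k) 1) (f a k)
    rw [Nat.succ_mul]
    omega

theorem pow (hf : PT f) (hg : PT g) (hgb : PB g) : PT (fun a => f a ^ g a) :=
  (prod (f := fun a _ => f a) hg hgb hf.fst).congr fun a => by simp

/-- Both branches are evaluated and the result is selected by arithmetic; `1 - (1 - b)` normalizes a
nonzero test value to 1. -/
theorem ite {p : α → Prop} [DecidablePred p] (hp : PTP p) (hf : PT f) (hg : PT g) :
    PT (fun a => if p a then f a else g a) := by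
  obtain ⟨b, hb, hbp⟩ := hp
  have h0 : PT fun a => 1 - b a := (const 1).sub hb
  refine ((((const 1).sub h0).mul hf).add (h0.mul hg)).congr fun a => ?_
  by_cases h : p a
  · have : b a ≠ 0 := (hbp a).2 h
    have h1 : 1 - b a = 0 := by omega
    simp [h, h1]
  · have : b a = 0 := not_not.1 (mt (hbp a).1 h)
    simp [h, this]

end PT

/-! ### Polynomial-time tests -/

namespace PTP

variable {f g : α → ℕ} {p q : α → Prop}

theorem le (hf : PT f) (hg : PT g) : PTP (fun a => f a ≤ g a) :=
  ⟨_, (PT.const 1).sub (hf.sub hg), fun a => by omega⟩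

theorem and (hp : PTP p) (hq : PTP q) : PTP (fun a => p a ∧ q a) := by
  obtain ⟨f, hf, hfp⟩ := hp
  obtain ⟨g, hg, hgq⟩ := hq
  exact ⟨_, hf.mul hg, fun a => by rw [mul_ne_zero_iff, hfp, hgq]⟩

theorem congr (hp : PTP p) (h : ∀ a, p a ↔ q a) : PTP q :=
  hp.imp fun _ hf => ⟨hf.1, fun a => (hf.2 a).trans (h a)⟩

theorem lt (hf : PT f) (hg : PT g) : PTP (fun a => f a < g a) :=
  le (hf.add (PT.const 1)) hg

theorem eq (hf : PT f) (hg : PT g) : PTP (fun a => f a = g a) :=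
  ((le hf hg).and (le hg hf)).congr fun _ => le_antisymm_iff.symm

theorem ball {n : α → ℕ} {p : α → ℕ → Prop} (hn : PT n) (hnb : PB n)
    (hp : PTP fun x : α × ℕ => p x.1 x.2) : PTP fun a => ∀ k < n a, p a k := by
  obtain ⟨f, hf, hfp⟩ := hp
  refine ⟨_, PT.prod (f := fun a k => f (a, k)) hn hnb hf, fun a => ?_⟩
  simp only [Finset.prod_ne_zero_iff, Finset.mem_range, hfp]

end PTP

end RAM

/-! ### The algorithm -/

namespace VMK

open RAM

/-- The digit of weight `b ^ i` of `x` in base `b`. -/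
def dig (x b i : ℕ) : ℕ := x / b ^ i % b

/-- The best one, according to `val`, of `init` and of the candidates that pass the test `ok`. -/
def best (val : ℕ → ℕ) (ok : ℕ → Prop) [DecidablePred ok] (N : ℕ) (c : ℕ → ℕ) (init : ℕ) : ℕ :=
  iter N (fun k acc => if ok (c k) ∧ val acc < val (c k) then c k else acc) init

section
variable (I : VMK)

/-- A common multiple of the denominators. -/
def den : ℕ := ∏ k ∈ Finset.range (3 * I.n), I.encode.getD (2 * k + 3) 0

/-- The two weights (`j = 0, 1`) and the profit (`j = 2`) of item `i`, multiplied by `I.den`. -/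
def amt (i j : ℕ) : ℕ :=
  I.encode.getD (6 * i + 2 * j + 2) 0 * (I.den / I.encode.getD (6 * i + 2 * j + 3) 0)

/-- The number of codes. A code `z` represents an assignment of items to bins: its digit for the
item `i` is `b + 1` if the item is in bin `b`, and `0` if it is not selected. -/
def codes : ℕ := (I.m + 1) ^ I.n

def load (z b j : ℕ) : ℕ :=
  ∑ i ∈ Finset.range I.n, if dig z (I.m + 1) i = b + 1 then I.amt i j else 0

def value (z : ℕ) : ℕ :=
  ∑ i ∈ Finset.range I.n, if dig z (I.m + 1) i = 0 then 0 else I.amt i 2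

def Feas (z : ℕ) : Prop := ∀ b < I.m, ∀ j < 2, I.load z b j ≤ I.den

instance : DecidablePred I.Feas := fun z => by unfold Feas; infer_instance

variable (K : ℕ)

/-- The partial assignment number `g`, of at most `K` items. -/
def guess (g : ℕ) : ℕ :=
  (∑ t ∈ Finset.range K, (dig g (I.n * (I.m + 1) + 1) t % (I.m + 1)) *
    (I.m + 1) ^ (dig g (I.n * (I.m + 1) + 1) t / (I.m + 1))) % I.codes

/-- The weight of item `i`, scaled to the capacity that the guess `y` leaves in bin `b`, rounded. -/
def rweight (y b j i : ℕ) : ℕ :=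
  I.amt i j * I.n * (2 * K + 1) / (I.den - I.load y b j + 1)

def rload (y z b j : ℕ) : ℕ :=
  ∑ i ∈ Finset.range I.n,
    if dig y (I.m + 1) i = 0 ∧ dig z (I.m + 1) i = b + 1 then I.rweight K y b j i else 0

/-- Each rounded capacity is less than `radix`. -/
def radix : ℕ := 2 * K * I.n + 1

/-- The number of vectors of rounded capacities. -/
def budgets : ℕ := I.radix K ^ (2 * I.m)

/-- The rounded load is within the budget `s`. -/
def Fits (y s z : ℕ) : Prop :=
  ∀ b < I.m, ∀ j < 2, I.rload K y z b j ≤ dig s (I.radix K) (2 * b + j)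

instance (y s : ℕ) : DecidablePred (I.Fits K y s) := fun z => by unfold Fits; infer_instance

/-- The candidate number `p` for item `i`, built from the entries of the table `t`. -/
def cand (t i p : ℕ) : ℕ :=
  (dig t I.codes (p / I.m) + (p % I.m + 1) * (I.m + 1) ^ i) % I.codes

/-- Instead of computing a predecessor budget, all old entries are combined with all bins and tested
against `s` directly. The initial value is the choice of leaving item `i` out. -/
def newEntry (y i t s : ℕ) : ℕ :=
  best I.value (I.Fits K y s) (I.budgets K * I.m) (I.cand t i) (dig t I.codes s)

/-- An item placed by the guess leaves the table unchanged. The reduction modulo `codes` has no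
effect when `y` is a code, but makes the size bound `table_lt` unconditional. -/
def newTable (y i t : ℕ) : ℕ :=
  if dig y (I.m + 1) i = 0 then
    ∑ s ∈ Finset.range (I.budgets K), I.newEntry K y i t s % I.codes * I.codes ^ s
  else t

/-- The table of the dynamic program for the guess `y`, packed into a number, after `i` items. -/
def table (y i : ℕ) : ℕ :=
  iter i (I.newTable K y) (∑ s ∈ Finset.range (I.budgets K), y % I.codes * I.codes ^ s)

def fullBudget : ℕ := ∑ e ∈ Finset.range (2 * I.m), 2 * K * I.n * I.radix K ^ e

def extend (y : ℕ) : ℕ := dig (I.table K y I.n) I.codes (I.fullBudget K)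

/-- The code of the computed solution. -/
def answer : ℕ :=
  best I.value I.Feas ((I.n * (I.m + 1) + 1) ^ K) (fun g => I.extend K (I.guess K g)) 0

/-- The output, as a number in binary. -/
def outWord : ℕ :=
  ∑ p ∈ Finset.range (I.m * I.n),
    (if dig (I.answer K) (I.m + 1) (p % I.n) = p / I.n + 1 then 1 else 0) * 2 ^ p

end

/-! ### Digits -/

theorem sum_mul_pow_lt {b : ℕ} (f : ℕ → ℕ) (n : ℕ) (hf : ∀ k < n, f k < b) :
    ∑ k ∈ Finset.range n, f k * b ^ k < b ^ n := by
  induction n with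
  | zero => simp
  | succ n ih =>
    rw [Finset.sum_range_succ, pow_succ]
    have h1 := ih fun k hk => hf k (by omega)
    have h2 : (f n + 1) * b ^ n ≤ b * b ^ n := Nat.mul_le_mul_right _ (hf n (by omega))
    rw [Nat.succ_mul] at h2
    rw [mul_comm (b ^ n)]
    omega

theorem dig_sum {b : ℕ} (f : ℕ → ℕ) (n : ℕ) (hf : ∀ k < n, f k < b) {i : ℕ} (hi : i < n) :
    dig (∑ k ∈ Finset.range n, f k * b ^ k) b i = f i := by
  have hb : 0 < b := (Nat.zero_le _).trans_lt (hf i hi)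
  induction n with
  | zero => omega
  | succ n ih =>
    have hlt := sum_mul_pow_lt f n fun k hk => hf k (by omega)
    rw [Finset.sum_range_succ]
    unfold dig
    rcases Nat.lt_succ_iff_lt_or_eq.1 hi with h | rfl
    · rw [← ih (fun k hk => hf k (by omega)) h]
      unfold dig
      obtain ⟨e, rfl⟩ : ∃ e, n = i + (e + 1) := ⟨n - i - 1, by omega⟩
      rw [show f (i + (e + 1)) * b ^ (i + (e + 1)) = b ^ i * (b * (f (i + (e + 1)) * b ^ e)) by ring,
        Nat.add_mul_div_left _ _ (pow_pos hb _), Nat.add_mul_mod_self_left]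
    · rw [Nat.add_mul_div_right _ _ (pow_pos hb _), Nat.div_eq_of_lt hlt, zero_add,
        Nat.mod_eq_of_lt (hf i hi)]

theorem dig_lt {b : ℕ} (hb : 0 < b) (x i : ℕ) : dig x b i < b := Nat.mod_lt _ hb

theorem sum_dig {b : ℕ} (n x : ℕ) (hx : x < b ^ n) :
    ∑ k ∈ Finset.range n, dig x b k * b ^ k = x := by
  have key : ∀ n, ∑ k ∈ Finset.range n, dig x b k * b ^ k = x % b ^ n := by
    intro n
    induction n with
    | zero => simp [Nat.mod_one]
    | succ n ih =>
      rw [Finset.sum_range_succ, ih, dig, pow_succ, Nat.mod_mul, mul_comm (b ^ n)]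
  rw [key, Nat.mod_eq_of_lt hx]

/-! ### Running time -/

section
variable {M : ℕ}

instance : Input {I : VMK // I.m ≤ M} where
  enc I := I.1.encode

variable {α : Type} [Ctx {I : VMK // I.m ≤ M} α]

/-- The instance of a context. -/
abbrev inst (a : α) : VMK := (Ctx.base a).1

theorem flatMap_getD {β : Type} (l : List β) (f : β → List ℕ) (c : ℕ) (hf : ∀ x, (f x).length = c)
    (i t : ℕ) (hi : i < l.length) (ht : t < c) :
    (l.flatMap f).getD (c * i + t) 0 = (f l[i]).getD t 0 := by
  induction l generalizing i with
  | nil => simp at hi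
  | cons x l ih =>
    rw [List.flatMap_cons]
    cases i with
    | zero =>
      rw [List.getD_append _ _ _ _ (by rw [hf]; omega)]
      simp
    | succ i =>
      have h : c * (i + 1) = c * i + c := by ring
      rw [List.getD_append_right _ _ _ _ (by rw [hf]; omega), hf,
        show c * (i + 1) + t - c = c * i + t by omega]
      exact ih i (by simpa using hi)

theorem encode_getD (I : VMK) (i : Fin I.n) (t : ℕ) (ht : t < 6) :
    I.encode.getD (6 * i + t + 2) 0 =
      [(I.w i 0).num.natAbs, (I.w i 0).den, (I.w i 1).num.natAbs, (I.w i 1).den,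
        (I.p i).num.natAbs, (I.p i).den].getD t 0 := by
  unfold encode
  rw [List.getD_append_right _ _ _ _ (by simp)]
  have := flatMap_getD (List.finRange I.n) (fun i : Fin I.n =>
    [(I.w i 0).num.natAbs, (I.w i 0).den, (I.w i 1).num.natAbs, (I.w i 1).den,
        (I.p i).num.natAbs, (I.p i).den]) 6 (fun _ => rfl) i t (by simp) ht
  simpa using this

theorem n_le_bitLength (I : VMK) : I.n ≤ bitLength I.encode := by
  have h1 : ∀ l : List ℕ, l.length ≤ bitLength l := by
    intro l
    induction l with
    | nil => simp
    | cons x l ih =>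
      simp only [bitLength, List.map_cons, List.sum_cons, List.length_cons] at ih ⊢
      omega
  have h2 : I.encode.length = 2 + I.n * 6 := by
    simp [encode, List.length_flatMap]
    omega
  have := h1 I.encode
  omega

theorem pb_n : PB fun a : α => (inst a).n :=
  PB.size.mono fun a => (n_le_bitLength _).trans (Ctx.bitLength_le a)

theorem pb_m : PB fun a : α => (inst a).m :=
  (PB.const M).mono fun a => (Ctx.base a).2

theorem pt_n : PT fun a : α => (inst a).n := (PT.const 0).mem

theorem pt_m : PT fun a : α => (inst a).m := (PT.const 1).mem

variable {x b i j : α → ℕ}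

theorem pt_dig (hx : PT x) (hb : PT b) (hi : PT i) (hi' : PB i) :
    PT fun a => dig (x a) (b a) (i a) :=
  (hx.div (hb.pow hi hi')).mod hb

theorem pt_den : PT fun a : α => (inst a).den :=
  PT.prod ((PT.const 3).mul pt_n) ((PB.const 3).mul pb_n)
    (f := fun a k => (inst a).encode.getD (2 * k + 3) 0)
    (PT.mem (((PT.const 2).mul PT.snd).add (PT.const 3)))

theorem pt_amt (hi : PT i) (hj : PT j) : PT fun a : α => (inst a).amt (i a) (j a) := by
  have h := ((PT.const 6).mul hi).add ((PT.const 2).mul hj)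
  exact (h.add (PT.const 2)).mem.mul (pt_den.div (h.add (PT.const 3)).mem)

theorem pt_base : PT fun a : α => (inst a).m + 1 := pt_m.add (PT.const 1)

theorem pt_codes : PT fun a : α => (inst a).codes := pt_base.pow pt_n pb_n

theorem pt_load (hx : PT x) (hb : PT b) (hj : PT j) :
    PT fun a : α => (inst a).load (x a) (b a) (j a) :=
  PT.sum pt_n pb_n (f := fun a i =>
      if dig (x a) ((inst a).m + 1) i = b a + 1 then (inst a).amt i (j a) else 0)
    (PT.ite (PTP.eq (pt_dig hx.fst pt_base.fst PT.snd PB.snd) (hb.fst.add (PT.const 1)))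
      (pt_amt PT.snd hj.fst) (PT.const 0))

theorem pt_value (hx : PT x) : PT fun a : α => (inst a).value (x a) :=
  PT.sum pt_n pb_n (f := fun a i =>
      if dig (x a) ((inst a).m + 1) i = 0 then 0 else (inst a).amt i 2)
    (PT.ite (PTP.eq (pt_dig hx.fst pt_base.fst PT.snd PB.snd) (PT.const 0))
      (PT.const 0) (pt_amt PT.snd (PT.const 2)))

theorem ptp_feas (hx : PT x) : PTP fun a : α => (inst a).Feas (x a) :=
  PTP.ball pt_m pb_m (p := fun a b => ∀ j < 2, (inst a).load (x a) b j ≤ (inst a).den)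
    (PTP.ball (PT.const 2) (PB.const 2)
      (p := fun (p : α × ℕ) j => (inst p.1).load (x p.1) p.2 j ≤ (inst p.1).den)
      (PTP.le (pt_load hx.fst.fst PT.snd.fst PT.snd) pt_den))

variable (K : ℕ)

theorem pt_guess (hx : PT x) : PT fun a : α => (inst a).guess K (x a) := by
  have hB : PT fun a : α => (inst a).n * ((inst a).m + 1) + 1 :=
    (pt_n.mul pt_base).add (PT.const 1)
  have hd : PT fun p : α × ℕ =>
      dig (x p.1) ((inst p.1).n * ((inst p.1).m + 1) + 1) p.2 :=
    pt_dig hx.fst hB.fst PT.snd PB.snd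
  refine (PT.sum (PT.const K) (PB.const K) (f := fun a t =>
    (dig (x a) ((inst a).n * ((inst a).m + 1) + 1) t % ((inst a).m + 1)) * ((inst a).m + 1) ^
      (dig (x a) ((inst a).n * ((inst a).m + 1) + 1) t / ((inst a).m + 1)))
    ((hd.mod pt_base.fst).mul (pt_base.fst.pow (hd.div pt_base.fst) (pb_n.fst.mono fun p => ?_)))).mod
    pt_codes
  -- A digit is at most n(m+1), so the item number extracted from it is at most n and the power has
  -- polynomial bit length.
  have := dig_lt (b := (inst p.1).n * ((inst p.1).m + 1) + 1) (Nat.succ_pos _) (x p.1) p.2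
  exact (Nat.div_le_div_right (Nat.lt_succ_iff.1 this)).trans (by simp)

variable {y s z t p : α → ℕ}

theorem pt_rweight (hy : PT y) (hb : PT b) (hj : PT j) (hi : PT i) :
    PT fun a : α => (inst a).rweight K (y a) (b a) (j a) (i a) :=
  (((pt_amt hi hj).mul pt_n).mul (PT.const _)).div
    ((pt_den.sub (pt_load hy hb hj)).add (PT.const 1))

theorem pt_rload (hy : PT y) (hz : PT z) (hb : PT b) (hj : PT j) :
    PT fun a : α => (inst a).rload K (y a) (z a) (b a) (j a) :=
  PT.sum pt_n pb_n (f := fun a i =>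
      if dig (y a) ((inst a).m + 1) i = 0 ∧ dig (z a) ((inst a).m + 1) i = b a + 1 then
        (inst a).rweight K (y a) (b a) (j a) i else 0)
    (PT.ite ((PTP.eq (pt_dig hy.fst pt_base.fst PT.snd PB.snd) (PT.const 0)).and
        (PTP.eq (pt_dig hz.fst pt_base.fst PT.snd PB.snd) (hb.fst.add (PT.const 1))))
      (pt_rweight K hy.fst hb.fst hj.fst PT.snd) (PT.const 0))

theorem pt_radix : PT fun a : α => (inst a).radix K := ((PT.const _).mul pt_n).add (PT.const 1)

theorem pb_radix : PB fun a : α => (inst a).radix K := ((PB.const _).mul pb_n).add (PB.const 1)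

theorem pt_budgets : PT fun a : α => (inst a).budgets K :=
  (pt_radix K).pow ((PT.const 2).mul pt_m) ((PB.const 2).mul pb_m)

/-- The constant bound on the number of bins is essential here: the exponent 2m is at most the
constant 2M. -/
theorem pb_budgets : PB fun a : α => (inst a).budgets K :=
  ((pb_radix K).pow (2 * M)).mono fun a =>
    Nat.pow_le_pow_right (Nat.succ_pos _) (Nat.mul_le_mul_left 2 (Ctx.base a).2)

theorem ptp_fits (hy : PT y) (hs : PT s) (hz : PT z) :
    PTP fun a : α => (inst a).Fits K (y a) (s a) (z a) :=
  PTP.ball pt_m pb_m (p := fun a b => ∀ j < 2, (inst a).rload K (y a) (z a) b j ≤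
      dig (s a) ((inst a).radix K) (2 * b + j))
    (PTP.ball (PT.const 2) (PB.const 2)
      (p := fun (p : α × ℕ) j => (inst p.1).rload K (y p.1) (z p.1) p.2 j ≤
        dig (s p.1) ((inst p.1).radix K) (2 * p.2 + j))
      (PTP.le (pt_rload K hy.fst.fst hz.fst.fst PT.snd.fst PT.snd)
        (pt_dig hs.fst.fst (pt_radix K) (((PT.const 2).mul PT.snd.fst).add PT.snd)
          (((PB.const 2).mul PB.snd.fst).add PB.snd))))

theorem best_mem (val : ℕ → ℕ) (ok : ℕ → Prop) [DecidablePred ok] (N : ℕ) (c : ℕ → ℕ)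
    (init : ℕ) : best val ok N c init = init ∨ ∃ k < N, best val ok N c init = c k ∧ ok (c k) := by
  induction N with
  | zero => exact Or.inl rfl
  | succ N ih =>
    unfold best at ih ⊢
    rw [iter_succ]
    split_ifs with h
    · exact Or.inr ⟨N, by omega, rfl, h.1⟩
    · exact ih.imp id fun ⟨k, hk, h⟩ => ⟨k, by omega, h⟩

/-- The accumulator is always the initial value or one of the candidates, so its bit length cannot
build up over the rounds. -/
theorem pt_best {val : α → ℕ → ℕ} {ok : α → ℕ → Prop} [∀ a, DecidablePred (ok a)] {N : α → ℕ}
    {c : α → ℕ → ℕ} {init : α → ℕ} (hN : PT N) (hN' : PB N)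
    (hval : PT fun q : (α × ℕ) × Big => val q.1.1 q.2.val)
    (hval' : PT fun q : α × ℕ => val q.1 (c q.1 q.2))
    (hok : PTP fun q : α × ℕ => ok q.1 (c q.1 q.2))
    (hc : PT fun q : α × ℕ => c q.1 q.2) (hinit : PT init) :
    PT fun a => best (val a) (ok a) (N a) (c a) (init a) := by
  obtain ⟨e, he⟩ := hc.size
  refine PT.iter (A := fun a => Nat.size (init a) + (Ctx.size a + N a + 2) ^ e)
    (step := fun a k acc => if ok a (c a k) ∧ val a acc < val a (c a k) then c a k else acc)
    hN hN' hinit (PT.ite (PTP.and ?_ (PTP.lt hval hval'.fst_big)) hc.fst_big PT.acc)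
    (hinit.size.add (((PB.size.add hN').add (PB.const 2)).pow e)) fun a k hk => ?_
  · obtain ⟨f, hf, hfp⟩ := hok
    exact ⟨_, hf.fst_big, fun q => hfp q.1⟩
  · rcases best_mem (val a) (ok a) k (c a) (init a) with h | ⟨j, hj, h, -⟩
    · exact (congrArg Nat.size h).le.trans (Nat.le_add_right _ _)
    · refine (congrArg Nat.size h).le.trans (((he (a, j)).trans (Nat.pow_le_pow_left ?_ e)).trans
        (Nat.le_add_left _ _))
      have : Ctx.size (a, j) = Ctx.size a + j := rfl
      omega

theorem pt_entry (ht : PT t) (hs : PT s) (hs' : PB s) :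
    PT fun a : α => dig (t a) (inst a).codes (s a) :=
  pt_dig ht pt_codes hs hs'

theorem pt_cand (ht : PT t) (hi : PT i) (hi' : PB i) (hp : PT p) (hp' : PB p) :
    PT fun a : α => (inst a).cand (t a) (i a) (p a) :=
  ((pt_entry ht (hp.div pt_m) (hp'.mono fun _ => Nat.div_le_self _ _)).add
    (((hp.mod pt_m).add (PT.const 1)).mul (pt_base.pow hi hi'))).mod pt_codes

theorem pt_newEntry (hy : PT y) (hi : PT i) (hi' : PB i) (ht : PT t) (hs : PT s) (hs' : PB s) :
    PT fun a : α => (inst a).newEntry K (y a) (i a) (t a) (s a) := by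
  have hc : PT fun q : α × ℕ => (inst q.1).cand (t q.1) (i q.1) q.2 :=
    pt_cand ht.fst hi.fst hi'.fst PT.snd PB.snd
  exact pt_best (val := fun a => (inst a).value) (ok := fun a => (inst a).Fits K (y a) (s a))
    (c := fun a => (inst a).cand (t a) (i a)) ((pt_budgets K).mul pt_m) ((pb_budgets K).mul pb_m)
    (pt_value (PT.acc (α := α × ℕ))) (pt_value hc) (ptp_fits K hy.fst hs.fst hc) hc
    (pt_entry ht hs hs')

theorem pt_newTable (hy : PT y) (hi : PT i) (hi' : PB i) (ht : PT t) :
    PT fun a : α => (inst a).newTable K (y a) (i a) (t a) :=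
  PT.ite (PTP.eq (pt_dig hy pt_base hi hi') (PT.const 0))
    (PT.sum (pt_budgets K) (pb_budgets K) (f := fun a s =>
      (inst a).newEntry K (y a) (i a) (t a) s % (inst a).codes * (inst a).codes ^ s)
      (((pt_newEntry K hy.fst hi.fst hi'.fst ht.fst PT.snd PB.snd).mod pt_codes.fst).mul
        (pt_codes.fst.pow PT.snd PB.snd))) ht

theorem codes_pos (I : VMK) : 0 < I.codes := pow_pos (Nat.succ_pos _) _

/-- Holds for every `y`, and bounds the bit length of the packed table as required by `PT.iter`. -/
theorem table_lt (I : VMK) (y i : ℕ) : I.table K y i < I.codes ^ I.budgets K := by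
  induction i with
  | zero => exact sum_mul_pow_lt _ _ fun _ _ => Nat.mod_lt _ I.codes_pos
  | succ i ih =>
    rw [table, iter_succ, newTable]
    split_ifs
    · exact sum_mul_pow_lt _ _ fun _ _ => Nat.mod_lt _ I.codes_pos
    · exact ih

theorem pb_size_codes : PB fun a : α => Nat.size (inst a).codes := pt_codes.size

theorem pt_table (hy : PT y) (hi : PT i) (hi' : PB i) :
    PT fun a : α => (inst a).table K (y a) (i a) :=
  PT.iter (A := fun a => (inst a).budgets K * Nat.size (inst a).codes + 1)
    (step := fun a i t => (inst a).newTable K (y a) i t)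
    (init := fun a => ∑ s ∈ Finset.range ((inst a).budgets K),
      y a % (inst a).codes * (inst a).codes ^ s) hi hi'
    (PT.sum (pt_budgets K) (pb_budgets K)
      (f := fun a s => y a % (inst a).codes * (inst a).codes ^ s)
      ((hy.mod pt_codes).fst.mul (pt_codes.fst.pow PT.snd PB.snd)))
    (pt_newTable K hy.fst.fst_big PT.snd.fst_big PB.snd.fst_big PT.acc)
    (((pb_budgets K).mul pb_size_codes).add (PB.const 1))
    fun a k _ => (Nat.size_le_size ((inst a).table_lt K (y a) k).le).trans (size_pow_le _ _)

theorem pt_fullBudget : PT fun a : α => (inst a).fullBudget K :=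
  PT.sum ((PT.const 2).mul pt_m) ((PB.const 2).mul pb_m)
    (f := fun a e => 2 * K * (inst a).n * (inst a).radix K ^ e)
    (((PT.const _).mul pt_n).mul ((pt_radix K).pow PT.snd PB.snd))

theorem fullBudget_lt (I : VMK) : I.fullBudget K < I.budgets K :=
  sum_mul_pow_lt _ _ fun _ _ => Nat.lt_succ_self _

theorem pt_extend (hy : PT y) : PT fun a : α => (inst a).extend K (y a) :=
  pt_entry (pt_table K hy pt_n pb_n) (pt_fullBudget K)
    ((pb_budgets K).mono fun a => ((inst a).fullBudget_lt K).le)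

theorem pt_answer : PT fun a : α => (inst a).answer K := by
  have hc : PT fun q : α × ℕ => (inst q.1).extend K ((inst q.1).guess K q.2) :=
    pt_extend K (pt_guess K PT.snd)
  exact pt_best (val := fun a => (inst a).value) (ok := fun a => (inst a).Feas)
    (c := fun a g => (inst a).extend K ((inst a).guess K g))
    (((pt_n.mul pt_base).add (PT.const 1)).pow (PT.const K) (PB.const K))
    (((pb_n.mul (pb_m.add (PB.const 1))).add (PB.const 1)).pow K)
    (pt_value (PT.acc (α := α × ℕ))) (pt_value hc) (ptp_feas hc) hc (PT.const 0)

theorem pt_outWord : PT fun a : α => (inst a).outWord K :=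
  PT.sum (pt_m.mul pt_n) (pb_m.mul pb_n)
    (f := fun a p => (if dig ((inst a).answer K) ((inst a).m + 1) (p % (inst a).n) =
      p / (inst a).n + 1 then 1 else 0) * 2 ^ p)
    ((PT.ite (PTP.eq (pt_dig (pt_answer K) pt_base (PT.snd.mod pt_n)
        (PB.snd.mono fun _ => Nat.mod_le _ _))
        ((PT.snd.div pt_n).add (PT.const 1))) (PT.const 1) (PT.const 0)).mul
      ((PT.const 2).pow PT.snd PB.snd))

end

end VMK

namespace RAM

/-! ### Writing the output -/

/-- One step of `outLoop`. -/
def outBody : Program :=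
  (Program.store (.reg 3)
    (.bin .sub (.reg 1) (.bin .mul (.const 2) (.bin .div (.reg 1) (.const 2))))).seq
  ((Program.assign 1 (.bin .div (.reg 1) (.const 2))).seq
    (.assign 3 (.bin .add (.reg 3) (.const 1))))

/-- Writes the bits of register `1` into the memory cells from register `3` up to register `2`. -/
def outLoop : Program := .loop (.bin .sub (.reg 2) (.reg 3)) outBody

theorem outBody_exec (s : State) (w l k : ℕ) (h1 : s.reg 1 = w) (h2 : s.reg 2 = l)
    (h3 : s.reg 3 = k) :
    ∃ s' t, Exec outBody s s' t ∧ s'.reg 1 = w / 2 ∧ s'.reg 2 = l ∧ s'.reg 3 = k + 1 ∧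
      s'.mem = Function.update s.mem k (w % 2) ∧ t ≤ 7 * Nat.size w + 4 * k + 40 := by
  refine ⟨_, _, (Exec.store _ _ _).seq ((Exec.assign _ _ _).seq (Exec.assign _ _ _)), ?_, ?_, ?_,
    ?_, ?_⟩
  · simp [Expr.eval, Op.eval, h1]
  · simp [h2]
  · simp [Expr.eval, Op.eval, h3]
  · have : w - 2 * (w / 2) = w % 2 := by omega
    simp [Expr.eval, Op.eval, h1, h3, this]
  · have a1 : Nat.size (w / 2) ≤ Nat.size w := Nat.size_le_size (Nat.div_le_self _ _)
    have a2 : Nat.size (2 * (w / 2)) ≤ Nat.size w := Nat.size_le_size (Nat.mul_div_le _ _)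
    have a3 : Nat.size (w - 2 * (w / 2)) ≤ Nat.size w := Nat.size_le_size (Nat.sub_le _ _)
    have a4 := size_le_self k
    have a5 := size_le_self (k + 1)
    have a6 := size_le_self 2
    have a7 := size_le_self 1
    simp [Expr.cost, Expr.eval, Op.eval, h1, h3]
    omega

theorem outLoop_exec (w l : ℕ) (j k : ℕ) (hk : k + j = l) (s : State) (h1 : s.reg 1 = w / 2 ^ k)
    (h2 : s.reg 2 = l) (h3 : s.reg 3 = k) (hm : ∀ p < k, s.mem p = w / 2 ^ p % 2) :
    ∃ s' t, Exec outLoop s s' t ∧ s'.reg 2 = l ∧ (∀ p < l, s'.mem p = w / 2 ^ p % 2) ∧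
      t ≤ (j + 1) * (7 * Nat.size w + 7 * l + 44) := by
  have z1 := size_le_self l
  have z2 := size_le_self k
  have z3 := size_le_self (l - k)
  induction j generalizing k s with
  | zero =>
    have hk : k = l := by omega
    subst hk
    refine ⟨s, _, Exec.loop_false (by simp [Expr.eval, Op.eval, h2, h3]), h2, hm, ?_⟩
    simp only [Expr.cost, Expr.eval, Op.eval, h2, h3]
    omega
  | succ j ih =>
    obtain ⟨s₁, t₁, e₁, q1, q2, q3, m₁, c₁⟩ := outBody_exec s _ _ _ h1 h2 h3
    obtain ⟨s', t', e', r', m', c'⟩ := ih (k + 1) (by omega) s₁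
      (by rw [q1, Nat.div_div_eq_div_mul, pow_succ]) q2 q3
      (fun p hp => by
        rw [m₁]
        by_cases h : p = k
        · simp [h]
        · rw [Function.update_of_ne h]
          exact hm p (by omega)) (size_le_self _) (size_le_self _)
    refine ⟨s', _, Exec.loop_true (by simp [Expr.eval, Op.eval, h2, h3]; omega) e₁ e', r', m', ?_⟩
    have a1 : Nat.size (w / 2 ^ k) ≤ Nat.size w := Nat.size_le_size (Nat.div_le_self _ _)
    have a2 : (j + 1 + 1) * (7 * Nat.size w + 7 * l + 44) =
      (7 * Nat.size w + 7 * l + 44) + (j + 1) * (7 * Nat.size w + 7 * l + 44) := by ring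
    simp only [Expr.cost, Expr.eval, Op.eval, h2, h3]
    omega

/-- The output is a 0-1 list packed into the bits of `W`. The input may be overwritten by these bits
because `W` and the length `L` have been computed into registers beforehand. -/
theorem exists_program {ι : Type} [Input ι] {W L : ι → ℕ} (hW : PT W) (hL : PT L) (hLb : PB L) :
    ∃ (P : Program) (q : Polynomial ℕ), ∀ a : ι, P.OutputsInTime (Input.enc a)
      ((List.range (L a)).map fun p => W a / 2 ^ p % 2) (q.eval (bitLength (Input.enc a))) := by
  obtain ⟨P₁, T₁, hT₁, hP₁⟩ := hW.exec () 1 trivial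
  obtain ⟨P₂, T₂, hT₂, hP₂⟩ := hL.exec () 2 trivial
  have hT : PB fun a => T₁ a + (T₂ a + (2 + ((L a + 1) * (7 * Nat.size (W a) + 7 * L a + 44) +
      (2 + L a)))) :=
    hT₁.add (hT₂.add ((PB.const 2).add (((hLb.add (PB.const 1)).mul
      ((((PB.const 7).mul hW.size).add ((PB.const 7).mul hLb)).add (PB.const 44))).add
        ((PB.const 2).add hLb))))
  obtain ⟨c, hc⟩ := hT
  refine ⟨P₁.seq (P₂.seq ((Program.assign 3 (.const 0)).seq (outLoop.seq (.assign 0 (.reg 2))))),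
    (Polynomial.X + Polynomial.C 2) ^ c, fun a => ?_⟩
  obtain ⟨s₁, t₁, e₁, m₁, r₁, v₁, c₁⟩ := hP₁ a (State.init (Input.enc a)) trivial rfl
  obtain ⟨s₂, t₂, e₂, m₂, r₂, v₂, c₂⟩ := hP₂ a s₁ trivial m₁
  obtain ⟨s₃, t₃, e₃, r₃, m₃, c₃⟩ := outLoop_exec (W a) (L a) (L a) 0 (by omega)
    { reg := Function.update s₂.reg 3 (Expr.eval s₂ (.const 0)), mem := s₂.mem }
    (by simp [r₂ 1 (by omega), v₁]) (by simp [v₂]) (by simp [Expr.eval]) (by simp)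
  refine ⟨_, _, e₁.seq (e₂.seq ((Exec.assign _ _ _).seq (e₃.seq (Exec.assign _ _ _)))), ?_, ?_⟩
  · simp only [State.output, Expr.eval, r₃, Function.update_self]
    exact List.map_congr_left fun p hp => m₃ p (List.mem_range.1 hp)
  · refine le_trans ?_ ((hc a).trans (le_of_eq ?_))
    · have := size_le_self (L a)
      simp only [Expr.cost, r₃, Nat.size_zero]
      omega
    · rw [Polynomial.eval_pow, Polynomial.eval_add, Polynomial.eval_X, Polynomial.eval_C]
      rfl

end RAM

namespace VMK

open RAM

/-! ### Codes -/

/-- The term `F i 0` stands on the left in order to avoid a subtraction in ℕ. -/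
theorem sum_update {b n : ℕ} (e i d : ℕ) (hi : i < n) (he : dig e b i = 0) (F : ℕ → ℕ → ℕ) :
    ∑ k ∈ Finset.range n, F k (Function.update (dig e b) i d k) + F i 0 =
      ∑ k ∈ Finset.range n, F k (dig e b k) + F i d := by
  have hi' := Finset.mem_range.2 hi
  rw [← Finset.add_sum_erase _ _ hi', ← Finset.add_sum_erase _ (fun k => F k (dig e b k)) hi',
    Function.update_self, he,
    Finset.sum_congr rfl fun k hk => by rw [Function.update_of_ne (Finset.ne_of_mem_erase hk)]]
  ring

/-- Changing a digit `0` of a code. -/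
theorem add_digit {b n : ℕ} {e i d : ℕ} (h : e < b ^ n) (hi : i < n) (hd : d < b)
    (he : dig e b i = 0) :
    e + d * b ^ i < b ^ n ∧
      ∀ k < n, dig (e + d * b ^ i) b k = Function.update (dig e b) i d k := by
  have hb : 0 < b := (Nat.zero_le _).trans_lt hd
  have hlt : ∀ k < n, Function.update (dig e b) i d k < b := fun k _ => by
    by_cases hk : k = i
    · subst hk; simpa using hd
    · rw [Function.update_of_ne hk]; exact dig_lt hb _ _
  have key : e + d * b ^ i = ∑ k ∈ Finset.range n, Function.update (dig e b) i d k * b ^ k := by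
    have := sum_update (b := b) e i d hi he fun k x => x * b ^ k
    rw [zero_mul, add_zero, sum_dig n e h] at this
    exact this.symm
  rw [key]
  exact ⟨sum_mul_pow_lt _ _ hlt, fun k hk => dig_sum _ _ hlt hk⟩

theorem sum_add_digit {b n : ℕ} {e i d : ℕ} (h : e < b ^ n) (hi : i < n) (hd : d < b)
    (he : dig e b i = 0) (F : ℕ → ℕ → ℕ) (hF : F i 0 = 0) :
    ∑ k ∈ Finset.range n, F k (dig (e + d * b ^ i) b k) =
      ∑ k ∈ Finset.range n, F k (dig e b k) + F i d := by
  rw [← sum_update e i d hi he, hF, add_zero]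
  exact Finset.sum_congr rfl fun k hk => by
    rw [(add_digit h hi hd he).2 k (Finset.mem_range.1 hk)]

/-- Removing an item from a code. -/
theorem exists_sub_digit {b n : ℕ} {z i : ℕ} (h : z < b ^ n) (hi : i < n) (hb : 0 < b) :
    ∃ e < b ^ n, e + dig z b i * b ^ i = z ∧ dig e b i = 0 ∧ ∀ k < n, k ≠ i → dig e b k = dig z b k := by
  let f := Function.update (dig z b) i 0
  have hlt : ∀ k < n, f k < b := fun k _ => by
    by_cases hk : k = i
    · subst hk; simpa [f] using hb
    · simp only [f]; rw [Function.update_of_ne hk]; exact dig_lt hb _ _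
  refine ⟨∑ k ∈ Finset.range n, f k * b ^ k, sum_mul_pow_lt _ _ hlt, ?_, ?_, fun k hk hki => ?_⟩
  · conv_rhs => rw [← sum_dig n z h]
    have hi' := Finset.mem_range.2 hi
    rw [← Finset.add_sum_erase _ _ hi', ← Finset.add_sum_erase _ (fun k => dig z b k * b ^ k) hi',
      Finset.sum_congr rfl fun k hk => by
        simp only [f]; rw [Function.update_of_ne (Finset.ne_of_mem_erase hk)]]
    simp [f, add_comm]
  · rw [dig_sum _ _ hlt hi]; simp [f]
  · rw [dig_sum _ _ hlt hk]; simp [f, hki]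

theorem le_best (val : ℕ → ℕ) (ok : ℕ → Prop) [DecidablePred ok] (N : ℕ) (c : ℕ → ℕ)
    (init : ℕ) : val init ≤ val (best val ok N c init) ∧
      ∀ k < N, ok (c k) → val (c k) ≤ val (best val ok N c init) := by
  induction N with
  | zero => exact ⟨le_rfl, by simp⟩
  | succ N ih =>
    unfold best at ih ⊢
    rw [iter_succ]
    split_ifs with h
    · refine ⟨ih.1.trans h.2.le, fun k hk hok => ?_⟩
      rcases Nat.lt_succ_iff_lt_or_eq.1 hk with hk | rfl
      · exact (ih.2 k hk hok).trans h.2.le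
      · exact le_rfl
    · refine ⟨ih.1, fun k hk hok => ?_⟩
      rcases Nat.lt_succ_iff_lt_or_eq.1 hk with hk | rfl
      · exact ih.2 k hk hok
      · exact not_lt.1 fun h' => h ⟨hok, h'⟩

end VMK

namespace VMK

open RAM

/-! ### The dynamic program -/

section
variable (I : VMK) (K : ℕ)

/-- `z` extends the guess `y` by some of the first `i` items. -/
structure Extends (y i z : ℕ) : Prop where
  lt : z < I.codes
  eq : ∀ k < I.n, dig y (I.m + 1) k ≠ 0 → dig z (I.m + 1) k = dig y (I.m + 1) k
  zero : ∀ k < I.n, i ≤ k → dig y (I.m + 1) k = 0 → dig z (I.m + 1) k = 0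

/-- The load of the items that are not in the guess `y`. -/
def extraLoad (y z b j : ℕ) : ℕ :=
  ∑ i ∈ Finset.range I.n,
    if dig y (I.m + 1) i = 0 ∧ dig z (I.m + 1) i = b + 1 then I.amt i j else 0

variable {I K}

theorem value_add_digit {e i d : ℕ} (h : e < I.codes) (hi : i < I.n) (hd : d < I.m + 1)
    (he : dig e (I.m + 1) i = 0) :
    I.value (e + d * (I.m + 1) ^ i) = I.value e + if d = 0 then 0 else I.amt i 2 :=
  sum_add_digit h hi hd he (fun k x => if x = 0 then 0 else I.amt k 2) rfl

theorem rload_add_digit {e i d : ℕ} (h : e < I.codes) (hi : i < I.n) (hd : d < I.m + 1)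
    (he : dig e (I.m + 1) i = 0) (y b j : ℕ) :
    I.rload K y (e + d * (I.m + 1) ^ i) b j =
      I.rload K y e b j + if dig y (I.m + 1) i = 0 ∧ d = b + 1 then I.rweight K y b j i else 0 :=
  sum_add_digit h hi hd he
    (fun k x => if dig y (I.m + 1) k = 0 ∧ x = b + 1 then I.rweight K y b j k else 0) (by simp)

theorem Extends.add_digit {y e i d : ℕ} (h : I.Extends y i e) (hi : i < I.n) (hd : d < I.m + 1)
    (hy : dig y (I.m + 1) i = 0) : I.Extends y (i + 1) (e + d * (I.m + 1) ^ i) := by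
  obtain ⟨h1, h2⟩ := VMK.add_digit h.lt hi hd (h.zero i hi le_rfl hy)
  refine ⟨h1, fun k hk hk' => ?_, fun k hk hik hk' => ?_⟩
  · rw [h2 k hk, Function.update_of_ne (by rintro rfl; exact hk' hy)]
    exact h.eq k hk hk'
  · rw [h2 k hk, Function.update_of_ne (by omega)]
    exact h.zero k hk (by omega) hk'

theorem Extends.succ {y e i : ℕ} (h : I.Extends y i e) : I.Extends y (i + 1) e :=
  ⟨h.lt, h.eq, fun k hk hik => h.zero k hk (by omega)⟩

theorem dig_fullBudget {e : ℕ} (he : e < 2 * I.m) :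
    dig (I.fullBudget K) (I.radix K) e = 2 * K * I.n :=
  dig_sum (fun _ => 2 * K * I.n) _ (fun _ _ => Nat.lt_succ_self _) he

/-- Exchange argument: if the competitor `z` puts item `i` in bin `b`, strip `i` off to get `e` and
let `s'` be the rounded loads of `e`. The old entry at `s'` is worth at least as much as `e` and
loads no bin more, so adding `i` back to it gives a candidate that fits wherever `z` does. -/
theorem newEntry_spec {y i t s : ℕ} (hi : i < I.n) (hy : dig y (I.m + 1) i = 0)
    (hs : s < I.budgets K)
    (ht : ∀ s < I.budgets K, I.Extends y i (dig t I.codes s) ∧ I.Fits K y s (dig t I.codes s) ∧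
      ∀ z, I.Extends y i z → I.Fits K y s z → I.value z ≤ I.value (dig t I.codes s)) :
    I.Extends y (i + 1) (I.newEntry K y i t s) ∧ I.Fits K y s (I.newEntry K y i t s) ∧
      ∀ z, I.Extends y (i + 1) z → I.Fits K y s z → I.value z ≤ I.value (I.newEntry K y i t s) := by
  have hcand : ∀ s' b, s' < I.budgets K → b < I.m →
      s' * I.m + b < I.budgets K * I.m ∧
      I.cand t i (s' * I.m + b) = dig t I.codes s' + (b + 1) * (I.m + 1) ^ i := by
    intro s' b hs' hb
    have hm : 0 < I.m := by omega
    refine ⟨?_, ?_⟩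
    · have : (s' + 1) * I.m ≤ I.budgets K * I.m := Nat.mul_le_mul_right _ hs'
      rw [Nat.succ_mul] at this
      omega
    · have h1 : (s' * I.m + b) / I.m = s' := by
        rw [mul_comm, Nat.mul_add_div hm, Nat.div_eq_of_lt hb, add_zero]
      have h2 : (s' * I.m + b) % I.m = b := by
        rw [mul_comm, Nat.mul_add_mod, Nat.mod_eq_of_lt hb]
      rw [cand, h1, h2]
      exact Nat.mod_eq_of_lt ((ht s' hs').1.add_digit hi (by omega) hy).lt
  constructor
  · rcases best_mem I.value (I.Fits K y s) (I.budgets K * I.m) (I.cand t i) (dig t I.codes s)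
      with h | ⟨p, hp, h, -⟩
    · rw [newEntry, h]
      exact (ht s hs).1.succ
    · rw [newEntry, h]
      have hm : 0 < I.m := Nat.pos_of_ne_zero fun h => by simp [h] at hp
      have hp' : p / I.m < I.budgets K := Nat.div_lt_of_lt_mul (by rwa [mul_comm])
      have := (hcand _ _ hp' (Nat.mod_lt p hm)).2
      rw [mul_comm, Nat.div_add_mod] at this
      rw [this]
      exact (ht _ hp').1.add_digit hi (by have := Nat.mod_lt p hm; omega) hy
  constructor
  · rcases best_mem I.value (I.Fits K y s) (I.budgets K * I.m) (I.cand t i) (dig t I.codes s)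
      with h | ⟨p, hp, h, hok⟩
    · rw [newEntry, h]
      exact (ht s hs).2.1
    · rw [newEntry, h]
      exact hok
  · intro z hz hzs
    obtain ⟨hb1, hb2⟩ := le_best I.value (I.Fits K y s) (I.budgets K * I.m) (I.cand t i)
      (dig t I.codes s)
    obtain ⟨e, he, hez, he0, hek⟩ := exists_sub_digit hz.lt hi (Nat.succ_pos I.m)
    have hext : I.Extends y i e := by
      refine ⟨he, fun k hk hk' => ?_, fun k hk hik hk' => ?_⟩
      · rw [hek k hk (by rintro rfl; exact hk' hy)]
        exact hz.eq k hk hk'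
      · by_cases hki : k = i
        · rw [hki, he0]
        · rw [hek k hk hki]
          exact hz.zero k hk (by omega) hk'
    have hd := dig_lt (Nat.succ_pos I.m) z i
    generalize hd' : dig z (I.m + 1) i = d at hd hez
    rcases Nat.eq_zero_or_pos d with rfl | hpos
    · rw [zero_mul, add_zero] at hez
      subst hez
      exact ((ht s hs).2.2 e hext hzs).trans hb1
    obtain ⟨b, rfl⟩ : ∃ b, d = b + 1 := ⟨d - 1, by omega⟩
    have hb : b < I.m := by omega
    have hR : 0 < I.radix K := Nat.succ_pos _
    -- The 2m rounded loads of `e` are listed with bin q / 2 and dimension q % 2. They are legal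
    -- digits because `z`, which loads at least as much, fits the budget `s`.
    let f : ℕ → ℕ := fun q => I.rload K y e (q / 2) (q % 2)
    have hf : ∀ q < 2 * I.m, f q < I.radix K := fun q hq => by
      have h1 := hzs (q / 2) (by omega) (q % 2) (by omega)
      rw [← hez, rload_add_digit he hi hd he0] at h1
      exact (Nat.le_add_right _ _).trans_lt (h1.trans_lt (dig_lt hR _ _))
    let s' := ∑ q ∈ Finset.range (2 * I.m), f q * I.radix K ^ q
    have hs' : s' < I.budgets K := sum_mul_pow_lt _ _ hf
    have hdig : ∀ b < I.m, ∀ j < 2, dig s' (I.radix K) (2 * b + j) = I.rload K y e b j := by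
      intro b hb j hj
      rw [dig_sum f _ hf (by omega)]
      simp only [f]
      rw [show (2 * b + j) / 2 = b by omega, show (2 * b + j) % 2 = j by omega]
    obtain ⟨ht1, ht2, ht3⟩ := ht s' hs'
    have ht0 := ht1.zero i hi le_rfl hy
    obtain ⟨hc1, hc2⟩ := hcand s' b hs' hb
    have hfit : I.Fits K y s (I.cand t i (s' * I.m + b)) := by
      intro b' hb' j hj
      refine le_trans ?_ (hzs b' hb' j hj)
      rw [hc2, rload_add_digit ht1.lt hi hd ht0, ← hez, rload_add_digit he hi hd he0]
      exact Nat.add_le_add_right ((ht2 b' hb' j hj).trans (hdig b' hb' j hj).le) _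
    refine le_trans ?_ (hb2 _ hc1 hfit)
    rw [hc2, ← hez, value_add_digit ht1.lt hi hd ht0, value_add_digit he hi hd he0]
    exact Nat.add_le_add_right (ht3 e hext fun b' hb' j hj => (hdig b' hb' j hj).ge) _

theorem table_spec {y : ℕ} (hy : y < I.codes) (i : ℕ) (hi : i ≤ I.n) :
    ∀ s < I.budgets K, I.Extends y i (dig (I.table K y i) I.codes s) ∧
      I.Fits K y s (dig (I.table K y i) I.codes s) ∧
      ∀ z, I.Extends y i z → I.Fits K y s z →
        I.value z ≤ I.value (dig (I.table K y i) I.codes s) := by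
  induction i with
  | zero =>
    intro s hs
    have h : dig (I.table K y 0) I.codes s = y := by
      rw [table, iter_zero, dig_sum _ _ (fun _ _ => Nat.mod_lt _ I.codes_pos) hs,
        Nat.mod_eq_of_lt hy]
    rw [h]
    -- Before any item is processed the only extension of `y` is `y` itself, whose rounded load
    -- vanishes, since that load counts only items outside the guess.
    refine ⟨⟨hy, fun _ _ _ => rfl, fun _ _ _ h => h⟩, fun b _ j _ => ?_, fun z hz _ => ?_⟩
    · rw [rload, Finset.sum_eq_zero]
      · exact Nat.zero_le _
      · intro k _
        rw [if_neg]
        rintro ⟨h1, h2⟩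
        omega
    · refine (Finset.sum_congr rfl fun k hk => ?_).le
      have : dig z (I.m + 1) k = dig y (I.m + 1) k := by
        have hk := Finset.mem_range.1 hk
        by_cases h0 : dig y (I.m + 1) k = 0
        · rw [hz.zero k hk (Nat.zero_le _) h0, h0]
        · exact hz.eq k hk h0
      rw [this]
  | succ i ih =>
    intro s hs
    have ih := ih (by omega)
    by_cases h0 : dig y (I.m + 1) i = 0
    · have h := newEntry_spec (by omega) h0 hs ih
      have he : dig (I.table K y (i + 1)) I.codes s = I.newEntry K y i (I.table K y i) s := by
        rw [table, iter_succ, newTable, if_pos h0,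
          dig_sum _ _ (fun _ _ => Nat.mod_lt _ I.codes_pos) hs]
        exact Nat.mod_eq_of_lt h.1.lt
      rw [he]
      exact h
    · have he : I.table K y (i + 1) = I.table K y i := by
        rw [table, iter_succ, newTable, if_neg h0]
        rfl
      rw [he]
      obtain ⟨h1, h2, h3⟩ := ih s hs
      refine ⟨h1.succ, h2, fun z hz => h3 z ⟨hz.lt, hz.eq, fun k hk hik hk' => ?_⟩⟩
      rcases hik.eq_or_lt with rfl | hik
      · exact absurd hk' h0
      · exact hz.zero k hk hik hk'

/-! ### Rounded loads against true loads -/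

theorem load_eq_add {y z : ℕ} (h : I.Extends y I.n z) (b j : ℕ) :
    I.load z b j = I.load y b j + I.extraLoad y z b j := by
  rw [load, load, extraLoad, ← Finset.sum_add_distrib]
  refine Finset.sum_congr rfl fun k hk => ?_
  by_cases h0 : dig y (I.m + 1) k = 0
  · simp [h0]
  · simp [h0, h.eq k (Finset.mem_range.1 hk) h0]

/-- Rounding down loses less than one unit per item, hence fewer than n units when n > 0, so the
true load is below 2Kn + n = (2K+1)n units, which is c + 1; by integrality it is at most c. Dividing
by c + 1 rather than c gives this strict inequality and covers a full bin, c = 0. -/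
theorem extraLoad_le {y z b j : ℕ} (h : I.rload K y z b j ≤ 2 * K * I.n) :
    I.extraLoad y z b j ≤ I.den - I.load y b j := by
  set c := I.den - I.load y b j with hc
  have h1 : I.extraLoad y z b j * (I.n * (2 * K + 1)) + I.n ≤
      (I.rload K y z b j + I.n) * (c + 1) := by
    have hn : I.n = ∑ _k ∈ Finset.range I.n, 1 := by simp
    -- With n written as a sum of ones, the inequality can be checked item by item.
    conv_lhs => arg 2; rw [hn]
    conv_rhs => arg 1; arg 2; rw [hn]
    rw [extraLoad, rload, Finset.sum_mul, ← Finset.sum_add_distrib, ← Finset.sum_add_distrib,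
      Finset.sum_mul]
    refine Finset.sum_le_sum fun k _ => ?_
    split_ifs
    · have := Nat.lt_div_mul_add (a := I.amt k j * I.n * (2 * K + 1)) (Nat.succ_pos c)
      rw [rweight, ← hc, ← mul_assoc, Nat.add_mul _ 1 (c + 1), one_mul]
      exact this
    · omega
  rcases Nat.eq_zero_or_pos I.n with h0 | hpos
  · simp [extraLoad, h0]
  · have h2 : (I.rload K y z b j + I.n) * (c + 1) ≤ (2 * K * I.n + I.n) * (c + 1) :=
      Nat.mul_le_mul_right _ (by omega)
    have h3 : I.extraLoad y z b j * (I.n * (2 * K + 1)) < (c + 1) * (I.n * (2 * K + 1)) := by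
      calc _ < I.extraLoad y z b j * (I.n * (2 * K + 1)) + I.n := by omega
        _ ≤ _ := h1.trans h2
        _ = _ := by ring
    exact Nat.lt_succ_iff.1 (Nat.lt_of_mul_lt_mul_right h3)

/-- Rounding down only helps: a load of at most 2K/(2K+1) · c is at most 2Kn units of size
(c+1)/(n(2K+1)). -/
theorem rload_le {y z b j : ℕ}
    (h : (2 * K + 1) * I.extraLoad y z b j ≤ 2 * K * (I.den - I.load y b j)) :
    I.rload K y z b j ≤ 2 * K * I.n := by
  set c := I.den - I.load y b j with hc
  have h1 : I.rload K y z b j * (c + 1) ≤ I.extraLoad y z b j * (I.n * (2 * K + 1)) := by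
    rw [extraLoad, rload, Finset.sum_mul, Finset.sum_mul]
    refine Finset.sum_le_sum fun k _ => ?_
    split_ifs
    · rw [rweight, ← mul_assoc]
      exact Nat.div_mul_le_self _ _
    · simp
  refine Nat.le_of_mul_le_mul_right (h1.trans ?_) (Nat.succ_pos c)
  calc _ = (2 * K + 1) * I.extraLoad y z b j * I.n := by ring
    _ ≤ 2 * K * c * I.n := Nat.mul_le_mul_right _ h
    _ ≤ 2 * K * (c + 1) * I.n := by gcongr; omega
    _ = _ := by ring

theorem extend_spec {y : ℕ} (hy : y < I.codes) (hf : I.Feas y) :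
    I.Feas (I.extend K y) ∧ ∀ z, I.Extends y I.n z →
      (∀ b < I.m, ∀ j < 2,
        (2 * K + 1) * I.extraLoad y z b j ≤ 2 * K * (I.den - I.load y b j)) →
      I.value z ≤ I.value (I.extend K y) := by
  obtain ⟨h1, h2, h3⟩ := table_spec (K := K) hy I.n le_rfl _ (I.fullBudget_lt K)
  refine ⟨fun b hb j hj => ?_, fun z hz h => h3 z hz fun b hb j hj => ?_⟩
  · have h4 := h2 b hb j hj
    rw [dig_fullBudget (by omega)] at h4
    have h5 := extraLoad_le h4
    have h6 := hf b hb j hj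
    rw [extend, load_eq_add h1]
    omega
  · rw [dig_fullBudget (by omega)]
    exact rload_le (h b hb j hj)

/-! ### Guesses -/

/-- Enumerate `G`: the digit of `g` for the element `i` is (m+1)·i plus the digit of `y` at `i`, and
the unused digits are 0 and contribute nothing. The extra 1 in the base keeps it positive when there
are no items. -/
theorem exists_guess {y : ℕ} (hy : y < I.codes) (G : Finset ℕ) (hG : ∀ i ∈ G, i < I.n)
    (hK : G.card ≤ K) (h0 : ∀ i < I.n, i ∉ G → dig y (I.m + 1) i = 0) :
    ∃ g < (I.n * (I.m + 1) + 1) ^ K, I.guess K g = y := by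
  let e := G.equivFin
  let f : ℕ → ℕ := fun t => if h : t < G.card then
    (I.m + 1) * (e.symm ⟨t, h⟩ : ℕ) + dig y (I.m + 1) (e.symm ⟨t, h⟩) else 0
  have hf : ∀ t < K, f t < I.n * (I.m + 1) + 1 := fun t _ => by
    by_cases h : t < G.card
    · simp only [f, h, dif_pos]
      have h1 := hG _ (e.symm ⟨t, h⟩).2
      have h2 := dig_lt (Nat.succ_pos I.m) y (e.symm ⟨t, h⟩)
      have h3 : ((e.symm ⟨t, h⟩ : ℕ) + 1) * (I.m + 1) ≤ I.n * (I.m + 1) :=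
        Nat.mul_le_mul_right _ h1
      rw [Nat.succ_mul] at h3
      rw [mul_comm (I.m + 1), Nat.lt_succ_iff]
      exact (Nat.add_le_add_left h2.le _).trans h3
    · simp [f, h]
  refine ⟨_, sum_mul_pow_lt f K hf, ?_⟩
  suffices h : ∑ t ∈ Finset.range K, dig (∑ k ∈ Finset.range K, f k * (I.n * (I.m + 1) + 1) ^ k)
      (I.n * (I.m + 1) + 1) t % (I.m + 1) * (I.m + 1) ^ (dig (∑ k ∈ Finset.range K,
      f k * (I.n * (I.m + 1) + 1) ^ k) (I.n * (I.m + 1) + 1) t / (I.m + 1)) = y by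
    rw [guess, h, Nat.mod_eq_of_lt hy]
  calc _ = ∑ t ∈ Finset.range K, f t % (I.m + 1) * (I.m + 1) ^ (f t / (I.m + 1)) :=
        Finset.sum_congr rfl fun t ht => by rw [dig_sum f K hf (Finset.mem_range.1 ht)]
    _ = ∑ t ∈ Finset.range G.card, f t % (I.m + 1) * (I.m + 1) ^ (f t / (I.m + 1)) := by
        refine (Finset.sum_subset (Finset.range_mono hK) fun t _ ht => ?_).symm
        simp [f, Finset.mem_range.not.1 ht]
    _ = ∑ t : Fin G.card, dig y (I.m + 1) (e.symm t) * (I.m + 1) ^ (e.symm t : ℕ) := by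
        rw [← Fin.sum_univ_eq_sum_range]
        refine Finset.sum_congr rfl fun t _ => ?_
        have h2 := dig_lt (Nat.succ_pos I.m) y (e.symm t)
        simp only [f, t.2, dif_pos, Fin.eta]
        rw [Nat.mul_add_mod, Nat.mod_eq_of_lt h2, Nat.mul_add_div (Nat.succ_pos _),
          Nat.div_eq_of_lt h2, add_zero]
    _ = ∑ i : G, dig y (I.m + 1) i * (I.m + 1) ^ (i : ℕ) :=
        Equiv.sum_comp e.symm fun i : G => dig y (I.m + 1) i * (I.m + 1) ^ (i : ℕ)
    _ = ∑ i ∈ G, dig y (I.m + 1) i * (I.m + 1) ^ i :=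
        Finset.sum_coe_sort G fun i => dig y (I.m + 1) i * (I.m + 1) ^ i
    _ = ∑ i ∈ Finset.range I.n, dig y (I.m + 1) i * (I.m + 1) ^ i :=
        Finset.sum_subset (fun i hi => Finset.mem_range.2 (hG i hi)) fun i hi hi' => by
          rw [h0 i (Finset.mem_range.1 hi) hi', zero_mul]
    _ = y := sum_dig _ _ hy

theorem feas_answer : I.Feas (I.answer K) := by
  rcases best_mem I.value I.Feas ((I.n * (I.m + 1) + 1) ^ K)
    (fun g => I.extend K (I.guess K g)) 0 with h | ⟨g, -, h, hok⟩
  · rw [answer, h]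
    intro b _ j _
    simp [load, dig]
  · rw [answer, h]
    exact hok

theorem value_le_answer {y z : ℕ} (hy : y < I.codes) (hf : I.Feas y) (G : Finset ℕ)
    (hG : ∀ i ∈ G, i < I.n) (hK : G.card ≤ K)
    (h0 : ∀ i < I.n, i ∉ G → dig y (I.m + 1) i = 0) (hz : I.Extends y I.n z)
    (h : ∀ b < I.m, ∀ j < 2,
      (2 * K + 1) * I.extraLoad y z b j ≤ 2 * K * (I.den - I.load y b j)) :
    I.value z ≤ I.value (I.answer K) := by
  obtain ⟨g, hg, rfl⟩ := exists_guess (K := K) hy G hG hK h0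
  obtain ⟨h1, h2⟩ := extend_spec (K := K) hy hf
  exact (h2 z hz h).trans ((le_best I.value I.Feas _
    (fun g => I.extend K (I.guess K g)) 0).2 g hg h1)

end

end VMK

namespace VMK

open RAM

/-! ### Making room in a bin -/

/-- Add items one by one until the threshold c is first reached; the last item overshoots it by at
most c. -/
theorem exists_subset_between (X : Finset ℕ) (a : ℕ → ℕ) (h c : ℕ) (ha : ∀ i ∈ X, h * a i ≤ c)
    (hX : c ≤ h * ∑ i ∈ X, a i) :
    ∃ Z ⊆ X, c ≤ h * ∑ i ∈ Z, a i ∧ h * ∑ i ∈ Z, a i ≤ 2 * c := by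
  induction X using Finset.induction_on with
  | empty => exact ⟨∅, le_rfl, hX, by simp⟩
  | insert i X hi ih =>
    by_cases hc : c ≤ h * ∑ i ∈ X, a i
    · obtain ⟨Z, hZ, h1⟩ := ih (fun i hi => ha i (Finset.mem_insert_of_mem hi)) hc
      exact ⟨Z, hZ.trans (Finset.subset_insert _ _), h1⟩
    · refine ⟨_, le_rfl, hX, ?_⟩
      have := ha i (Finset.mem_insert_self i X)
      rw [Finset.sum_insert hi, Nat.mul_add]
      omega

/-- The load suffices to split off K + 1 disjoint chunks, each of scaled load between c and 2c, and
some chunk has at most the average profit. In the induction, either the first chunk is cheap enough,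
or a cheap chunk of the rest is no dearer than the first one, and averaging carries over. -/
theorem exists_cheap_subset (K : ℕ) (X : Finset ℕ) (a p : ℕ → ℕ) (h c : ℕ)
    (ha : ∀ i ∈ X, h * a i ≤ c) (hX : 2 * (K + 1) * c ≤ h * ∑ i ∈ X, a i) :
    ∃ Z ⊆ X, c ≤ h * ∑ i ∈ Z, a i ∧ (K + 1) * ∑ i ∈ Z, p i ≤ ∑ i ∈ X, p i := by
  induction K generalizing X with
  | zero => exact ⟨X, le_rfl, by omega, by simp⟩
  | succ K ih =>
    have e : 2 * (K + 1 + 1) * c = 2 * (K + 1) * c + 2 * c := by ring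
    obtain ⟨Z, hZ, h1, h2⟩ := exists_subset_between X a h c ha (by nlinarith)
    by_cases hp : (K + 1 + 1) * ∑ i ∈ Z, p i ≤ ∑ i ∈ X, p i
    · exact ⟨Z, hZ, h1, hp⟩
    · have sa := Finset.sum_sdiff hZ (f := a)
      have sp := Finset.sum_sdiff hZ (f := p)
      rw [← sa, Nat.mul_add h, e] at hX
      obtain ⟨Z', hZ', h3, h4⟩ := ih (X \ Z) (fun i hi => ha i (Finset.mem_sdiff.1 hi).1)
        (by omega)
      refine ⟨Z', hZ'.trans Finset.sdiff_subset, h3, ?_⟩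
      rw [← sp]
      have h5 : (K + 1) * ∑ i ∈ Z', p i ≤ (K + 1) * ∑ i ∈ Z, p i := by
        rw [← sp, Nat.succ_mul] at hp
        omega
      have h6 := Nat.le_of_mul_le_mul_left h5 (Nat.succ_pos K)
      rw [Nat.succ_mul]
      omega

/-- If one item weighs at least c/(2K+1), remove it alone. Otherwise all items are small; unless the
load is already low enough, it exceeds 2Kc/(2K+1), which is room for K chunks of weight between
c/(2K+1) and twice that, and a cheap chunk is removed. -/
theorem exists_removal {K : ℕ} (hK : 0 < K) (X : Finset ℕ) (a p : ℕ → ℕ) (c P : ℕ)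
    (ha : ∑ i ∈ X, a i ≤ c) (hp : ∀ i ∈ X, K * p i ≤ P) (hP : ∑ i ∈ X, p i ≤ P) :
    ∃ Z ⊆ X, K * ∑ i ∈ Z, p i ≤ P ∧ (2 * K + 1) * ∑ i ∈ X \ Z, a i ≤ 2 * K * c := by
  -- Removing weight c/(2K+1) from a load of at most c is enough.
  have key : ∀ Z ⊆ X, c ≤ (2 * K + 1) * ∑ i ∈ Z, a i →
      (2 * K + 1) * ∑ i ∈ X \ Z, a i ≤ 2 * K * c := fun Z hZ h => by
    have h1 := Nat.mul_le_mul_left (2 * K + 1) ha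
    rw [← Finset.sum_sdiff hZ, Nat.mul_add, Nat.succ_mul _ c] at h1
    omega
  by_cases h1 : ∃ i ∈ X, c ≤ (2 * K + 1) * a i
  · obtain ⟨i, hi, hc⟩ := h1
    have hZ := Finset.singleton_subset_iff.2 hi
    exact ⟨{i}, hZ, by simpa using hp i hi, key _ hZ (by simpa using hc)⟩
  · push Not at h1
    by_cases h2 : (2 * K + 1) * ∑ i ∈ X, a i ≤ 2 * K * c
    · exact ⟨∅, by simp, by simp, by simpa using h2⟩
    · obtain ⟨k, rfl⟩ : ∃ k, K = k + 1 := ⟨K - 1, by omega⟩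
      obtain ⟨Z, hZ, h3, h4⟩ := exists_cheap_subset k X a p (2 * (k + 1) + 1) c
        (fun i hi => (h1 i hi).le) (not_le.1 h2).le
      exact ⟨Z, hZ, h4.trans hP, key Z hZ h3⟩

theorem sum_biUnion_le {β : Type*} (Q : Finset β) (Z : β → Finset ℕ) (p : ℕ → ℕ) :
    ∑ i ∈ Q.biUnion Z, p i ≤ ∑ q ∈ Q, ∑ i ∈ Z q, p i := by
  classical
  induction Q using Finset.induction_on with
  | empty => simp
  | insert q Q hq ih =>
    rw [Finset.biUnion_insert, Finset.sum_insert hq]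
    have := Finset.sum_union_inter (s₁ := Z q) (s₂ := Q.biUnion Z) (f := p)
    omega

/-! ### Near-optimality of the answer -/

section
variable {I : VMK} {K : ℕ}

/-- The code with given digits. -/
theorem exists_code (f : ℕ → ℕ) (hf : ∀ i, f i ≤ I.m) :
    ∃ z < I.codes, ∀ i < I.n, dig z (I.m + 1) i = f i :=
  ⟨_, sum_mul_pow_lt f I.n fun i _ => Nat.lt_succ_iff.2 (hf i),
    fun _ hi => dig_sum f _ (fun i _ => Nat.lt_succ_iff.2 (hf i)) hi⟩

/-- Compare the answer with the assignment `σ` after thinning: `y` is its restriction to the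
valuable items `G`, and `z` is `σ` without the removed set `U`. -/
theorem near_optimal (hK : 0 < K) (σ : ℕ → ℕ) (hσ : ∀ i, σ i ≤ I.m)
    (hload : ∀ b < I.m, ∀ j < 2,
      ∑ i ∈ Finset.range I.n with σ i = b + 1, I.amt i j ≤ I.den) :
    K * ∑ i ∈ Finset.range I.n with σ i ≠ 0, I.amt i 2 ≤
      K * I.value (I.answer K) + 2 * I.m * ∑ i ∈ Finset.range I.n with σ i ≠ 0, I.amt i 2 := by
  classical
  set p : ℕ → ℕ := fun i => I.amt i 2 with hp
  set A := (Finset.range I.n).filter fun i => σ i ≠ 0 with hA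
  set P := ∑ i ∈ A, I.amt i 2 with hP
  set G := A.filter fun i => P < K * p i with hG
  let X : ℕ → Finset ℕ := fun b => (A \ G).filter fun i => σ i = b + 1
  have hGA : G ⊆ A := Finset.filter_subset _ _
  have hAn : ∀ i ∈ A, i < I.n := fun i hi => Finset.mem_range.1 (Finset.mem_filter.1 hi).1
  obtain ⟨y, hy, hyd⟩ := exists_code (I := I) (fun i => if i ∈ G then σ i else 0)
    fun i => by split_ifs; exacts [hσ i, Nat.zero_le _]
  have hy0 : ∀ i ∈ Finset.range I.n, dig y (I.m + 1) i = 0 ↔ i ∉ G := fun i hi => by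
    rw [hyd i (Finset.mem_range.1 hi)]
    by_cases h : i ∈ G
    · simp [h, (Finset.mem_filter.1 (hGA h)).2]
    · simp [h]
  have hyload : ∀ b j, I.load y b j = ∑ i ∈ G with σ i = b + 1, I.amt i j := fun b j => by
    rw [load, ← Finset.sum_filter]
    refine Finset.sum_congr (Finset.ext fun i => ?_) fun _ _ => rfl
    rw [Finset.mem_filter, Finset.mem_filter]
    constructor
    · rintro ⟨hi, h⟩
      rw [hyd i (Finset.mem_range.1 hi)] at h
      split_ifs at h with hiG
      exact ⟨hiG, h⟩
    · rintro ⟨hi, h⟩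
      have hin := hAn i (hGA hi)
      exact ⟨Finset.mem_range.2 hin, by rw [hyd i hin, if_pos hi, h]⟩
  have hsplit : ∀ b < I.m, ∀ j < 2, ∑ i ∈ X b, I.amt i j + I.load y b j ≤ I.den :=
    fun b hb j hj => by
      refine le_trans (le_of_eq ?_) (hload b hb j hj)
      rw [hyload, ← Finset.sum_union]
      · refine Finset.sum_congr (Finset.ext fun i => ?_) fun _ _ => rfl
        simp only [X, Finset.mem_union, Finset.mem_filter, Finset.mem_sdiff]
        constructor
        · rintro (⟨⟨h1, -⟩, h2⟩ | ⟨h1, h2⟩)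
          · exact ⟨(Finset.mem_filter.1 h1).1, h2⟩
          · exact ⟨(Finset.mem_filter.1 (hGA h1)).1, h2⟩
        · rintro ⟨h1, h2⟩
          by_cases h : i ∈ G
          · exact Or.inr ⟨h, h2⟩
          · exact Or.inl ⟨⟨Finset.mem_filter.2 ⟨h1, by omega⟩, h⟩, h2⟩
      · rw [Finset.disjoint_left]
        intro i h1 h2
        exact (Finset.mem_sdiff.1 (Finset.mem_filter.1 h1).1).2 (Finset.mem_filter.1 h2).1
  -- More than K items of profit above P/K would exceed the total P; the degenerate case P = 0 is
  -- excluded because then no item has K·p > P.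
  have hcard : G.card ≤ K := by
    by_contra hlt
    have h1 : G.card * P ≤ ∑ i ∈ G, K * p i := by
      rw [← smul_eq_mul]
      exact Finset.card_nsmul_le_sum _ _ _ fun i hi => (Finset.mem_filter.1 hi).2.le
    have h2 : ∑ i ∈ G, K * p i ≤ K * P := by
      rw [← Finset.mul_sum]
      exact Nat.mul_le_mul_left _ (Finset.sum_le_sum_of_subset hGA)
    have h3 : (K + 1) * P ≤ G.card * P := Nat.mul_le_mul_right _ (by omega)
    have h4 : P = 0 := by
      rw [Nat.succ_mul] at h3
      omega
    obtain ⟨i, hi⟩ := Finset.card_pos.1 (show 0 < G.card by omega)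
    have h5 := (Finset.mem_filter.1 hi).2
    have h6 : p i ≤ P := Finset.single_le_sum (f := p) (fun _ _ => Nat.zero_le _) (hGA hi)
    have h7 : p i = 0 := by omega
    rw [h7, mul_zero] at h5
    omega
  have hrem : ∀ b j, ∃ Z ⊆ X b, K * ∑ i ∈ Z, p i ≤ P ∧ (b < I.m → j < 2 →
      (2 * K + 1) * ∑ i ∈ X b \ Z, I.amt i j ≤ 2 * K * (I.den - I.load y b j)) := by
    intro b j
    by_cases h : b < I.m ∧ j < 2
    · have h1 := hsplit b h.1 j h.2
      obtain ⟨Z, hZ, h2, h3⟩ := exists_removal hK (X b) (fun i => I.amt i j) p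
        (I.den - I.load y b j) P (by omega)
        (fun i hi => by
          have h4 := Finset.mem_sdiff.1 (Finset.mem_filter.1 hi).1
          by_contra hc
          exact h4.2 (Finset.mem_filter.2 ⟨h4.1, not_le.1 hc⟩))
        (Finset.sum_le_sum_of_subset ((Finset.filter_subset _ _).trans Finset.sdiff_subset))
      exact ⟨Z, hZ, h2, fun _ _ => h3⟩
    · exact ⟨∅, by simp, by simp, fun h1 h2 => absurd ⟨h1, h2⟩ h⟩
  choose Z hZX hZp hZa using hrem
  let Q := Finset.range I.m ×ˢ Finset.range 2
  let U := Q.biUnion fun q => Z q.1 q.2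
  -- Only items outside `G` are removed, so `z` still extends the guess `y`.
  have hUA : U ⊆ A \ G := Finset.biUnion_subset.2 fun q _ =>
    (hZX _ _).trans (Finset.filter_subset _ _)
  have hUp : K * ∑ i ∈ U, p i ≤ 2 * I.m * P := by
    calc K * ∑ i ∈ U, p i ≤ K * ∑ q ∈ Q, ∑ i ∈ Z q.1 q.2, p i :=
          Nat.mul_le_mul_left _ (sum_biUnion_le _ _ _)
      _ = ∑ q ∈ Q, K * ∑ i ∈ Z q.1 q.2, p i := Finset.mul_sum _ _ _
      _ ≤ ∑ q ∈ Q, P := Finset.sum_le_sum fun q _ => hZp _ _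
      _ = 2 * I.m * P := by simp [Q, mul_comm]
  obtain ⟨z, hz, hzd⟩ := exists_code (I := I) (fun i => if i ∈ U then 0 else σ i)
    fun i => by split_ifs; exacts [Nat.zero_le _, hσ i]
  have hext : I.Extends y I.n z := by
    refine ⟨hz, fun i hi h => ?_, fun i hi h => by omega⟩
    have hiG : i ∈ G := by
      by_contra hc
      exact h ((hy0 i (Finset.mem_range.2 hi)).2 hc)
    rw [hzd i hi, hyd i hi, if_pos hiG, if_neg fun hU => (Finset.mem_sdiff.1 (hUA hU)).2 hiG]
  have hbound := value_le_answer hy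
    (fun b hb j hj => (Nat.le_add_left _ _).trans (hsplit b hb j hj)) G
    (fun i hi => hAn i (hGA hi)) hcard
    (fun i hi h => (hy0 i (Finset.mem_range.2 hi)).2 h) hext
    (fun b hb j hj => by
      refine le_trans (Nat.mul_le_mul_left _ ?_) (hZa b j hb hj)
      rw [extraLoad, ← Finset.sum_filter]
      refine Finset.sum_le_sum_of_subset fun i hi => ?_
      obtain ⟨hi, h1, h2⟩ := Finset.mem_filter.1 hi
      have hiG := (hy0 i hi).1 h1
      rw [hzd i (Finset.mem_range.1 hi)] at h2
      split_ifs at h2 with hU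
      refine Finset.mem_sdiff.2 ⟨Finset.mem_filter.2 ⟨Finset.mem_sdiff.2
        ⟨Finset.mem_filter.2 ⟨hi, by omega⟩, hiG⟩, h2⟩, fun hc => hU ?_⟩
      exact Finset.mem_biUnion.2 ⟨(b, j), by simp [Q, hb, hj], hc⟩)
  have hval : I.value z = ∑ i ∈ A \ U, p i := by
    have : I.value z = ∑ i ∈ Finset.range I.n, if ¬dig z (I.m + 1) i = 0 then p i else 0 :=
      Finset.sum_congr rfl fun i _ => by split_ifs <;> simp_all
    rw [this, ← Finset.sum_filter]
    refine Finset.sum_congr (Finset.ext fun i => ?_) fun _ _ => rfl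
    rw [Finset.mem_filter, Finset.mem_sdiff, hA, Finset.mem_filter, and_assoc]
    refine and_congr_right fun hi => ?_
    rw [hzd i (Finset.mem_range.1 hi)]
    by_cases hU : i ∈ U <;> simp [hU]
  have hsum := Finset.sum_sdiff (hUA.trans Finset.sdiff_subset) (f := p)
  rw [← hval] at hsum
  calc K * P = K * I.value z + K * ∑ i ∈ U, p i := by rw [← Nat.mul_add, hsum]
    _ ≤ _ := Nat.add_le_add (Nat.mul_le_mul_left _ hbound) hUp

end

/-! ### Rational weights and profits -/

section
variable {I : VMK}

theorem getD_pos {k : ℕ} (hk : k < 3 * I.n) : 0 < I.encode.getD (2 * k + 3) 0 := by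
  have h := encode_getD I ⟨k / 3, by omega⟩ (2 * (k % 3) + 1) (by omega)
  rw [show 6 * (k / 3) + (2 * (k % 3) + 1) + 2 = 2 * k + 3 by omega] at h
  rw [h]
  have : k % 3 < 3 := Nat.mod_lt _ (by norm_num)
  interval_cases k % 3 <;> simp [Rat.den_pos]

theorem den_pos : 0 < I.den :=
  Finset.prod_pos fun _ hk => getD_pos (Finset.mem_range.1 hk)

theorem cast_amt (i : Fin I.n) (j : ℕ) (hj : j < 3) {q : ℚ} (hq : 0 ≤ q)
    (h1 : I.encode.getD (6 * i + 2 * j + 2) 0 = q.num.natAbs)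
    (h2 : I.encode.getD (6 * i + 2 * j + 3) 0 = q.den) :
    (I.amt i j : ℚ) = I.den * q := by
  have hd : q.den ∣ I.den := by
    -- This denominator is factor number 3i + j of the product `den`, so the division in `amt` is
    -- exact.
    rw [← h2, show 6 * (i : ℕ) + 2 * j + 3 = 2 * (3 * i + j) + 3 by ring]
    exact Finset.dvd_prod_of_mem (fun k => I.encode.getD (2 * k + 3) 0)
      (Finset.mem_range.2 (by omega))
  rw [amt, h1, h2, Nat.cast_mul, Nat.cast_div hd (by exact_mod_cast q.den_ne_zero)]
  have h3 : (q.num.natAbs : ℚ) = q.num := by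
    rw [Nat.cast_natAbs, abs_of_nonneg (Rat.num_nonneg.2 hq)]
  rw [h3]
  conv_rhs => rw [← Rat.num_div_den q]
  ring

theorem cast_amt_w (i : Fin I.n) (j : Fin 2) : (I.amt i j : ℚ) = I.den * I.w i j := by
  refine cast_amt i j (by omega) (I.w_nonneg i j) ?_ ?_
  · have := encode_getD I i (2 * j) (by omega)
    rw [this]
    fin_cases j <;> rfl
  · have := encode_getD I i (2 * j + 1) (by omega)
    rw [show 6 * (i : ℕ) + 2 * j + 3 = 6 * i + (2 * j + 1) + 2 by ring, this]
    fin_cases j <;> rfl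

theorem cast_amt_p (i : Fin I.n) : (I.amt i 2 : ℚ) = I.den * I.p i :=
  cast_amt i 2 (by omega) (I.p_nonneg i) (encode_getD I i 4 (by omega))
    (encode_getD I i 5 (by omega))

/-- The solution represented by a code. -/
def decode (I : VMK) (z : ℕ) (b : Fin I.m) : Finset (Fin I.n) :=
  Finset.univ.filter fun i => dig z (I.m + 1) i = b + 1

theorem cast_load (z : ℕ) (b : Fin I.m) (j : Fin 2) :
    (I.load z b j : ℚ) = I.den * ∑ i ∈ I.decode z b, I.w i j := by
  rw [load, ← Fin.sum_univ_eq_sum_range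
    (fun i => if dig z (I.m + 1) i = b + 1 then I.amt i j else 0), ← Finset.sum_filter,
    Nat.cast_sum, Finset.mul_sum]
  exact Finset.sum_congr rfl fun i _ => cast_amt_w i j

theorem cast_value (z : ℕ) : (I.value z : ℚ) = I.den * I.profit (I.decode z) := by
  have h : I.value z = ∑ i ∈ Finset.range I.n, if dig z (I.m + 1) i ≠ 0 then I.amt i 2 else 0 :=
    Finset.sum_congr rfl fun i _ => by split_ifs <;> simp_all
  rw [h, profit, ← Fin.sum_univ_eq_sum_range
    (fun i => if dig z (I.m + 1) i ≠ 0 then I.amt i 2 else 0), ← Finset.sum_filter,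
    Nat.cast_sum, Finset.mul_sum]
  refine Finset.sum_congr (Finset.ext fun i => ?_) fun i _ => cast_amt_p i
  simp only [Finset.mem_filter, Finset.mem_univ, true_and, Finset.mem_biUnion, decode]
  refine ⟨fun h => ?_, fun ⟨b, h⟩ => by omega⟩
  have : dig z (I.m + 1) i < I.m + 1 := dig_lt (Nat.succ_pos I.m) z i
  exact ⟨⟨dig z (I.m + 1) i - 1, by omega⟩, by simp only; omega⟩

theorem isSolution_decode {z : ℕ} (hz : I.Feas z) : I.IsSolution (I.decode z) := by
  intro b j
  have h : (I.load z b j : ℚ) ≤ I.den := by exact_mod_cast hz b b.2 j j.2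
  rw [cast_load] at h
  have hd : (0 : ℚ) < I.den := by exact_mod_cast I.den_pos
  nlinarith

theorem near_opt {K : ℕ} (hK : 0 < K) :
    (K : ℚ) * I.opt ≤ K * I.profit (I.decode (I.answer K)) + 2 * I.m * I.opt := by
  classical
  obtain ⟨S, hS, hopt⟩ := Finset.exists_mem_eq_sup' (s := Finset.univ.filter I.IsSolution)
    ⟨fun _ => ∅, by simp [IsSolution]⟩ I.profit
  have hS : I.IsSolution S := (Finset.mem_filter.1 hS).2
  have hopt : I.opt = I.profit S := by
    rw [← hopt]
    unfold opt
    congr!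
  -- Each selected item keeps just one of its bins: the profit counts it once anyway, and dropping
  -- the other copies only lowers the loads.
  let σ : ℕ → ℕ := fun i =>
    if h : ∃ b : Fin I.m, ∃ hi : i < I.n, (⟨i, hi⟩ : Fin I.n) ∈ S b then h.choose + 1 else 0
  have hσ : ∀ i, σ i ≤ I.m := fun i => by
    simp only [σ]
    split_ifs with h
    · exact h.choose.2
    · exact Nat.zero_le _
  have hσS : ∀ (i : Fin I.n) (b : Fin I.m), σ i = b + 1 → i ∈ S b := fun i b h => by
    simp only [σ] at h
    split_ifs at h with h'
    have : h'.choose = b := Fin.ext (by omega)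
    rw [← this]
    exact h'.choose_spec.choose_spec
  have hd : (0 : ℚ) < I.den := by exact_mod_cast I.den_pos
  have hP : ((∑ i ∈ Finset.range I.n with σ i ≠ 0, I.amt i 2 : ℕ) : ℚ) = I.den * I.opt := by
    rw [hopt, profit, Finset.sum_filter, ← Fin.sum_univ_eq_sum_range
      (fun i => if σ i ≠ 0 then I.amt i 2 else 0), ← Finset.sum_filter, Nat.cast_sum,
      Finset.mul_sum]
    refine Finset.sum_congr (Finset.ext fun i => ?_) fun i _ => cast_amt_p i
    simp only [Finset.mem_filter, Finset.mem_univ, true_and, Finset.mem_biUnion]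
    constructor
    · intro h
      have := hσ i
      exact ⟨⟨σ i - 1, by omega⟩, hσS i _ (by simp only; omega)⟩
    · rintro ⟨b, hb⟩
      have h : ∃ b : Fin I.m, ∃ hi : (i : ℕ) < I.n, (⟨i, hi⟩ : Fin I.n) ∈ S b := ⟨b, i.2, hb⟩
      simp only [σ]
      rw [dif_pos h]
      omega
  have hmain := near_optimal hK σ hσ fun b hb j hj => by
    have h1 : ((∑ i ∈ Finset.range I.n with σ i = b + 1, I.amt i j : ℕ) : ℚ) ≤ I.den := by
      let T : Finset (Fin I.n) := Finset.univ.filter fun i : Fin I.n => σ i = b + 1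
      have h2 : ∑ i ∈ T, I.w i ⟨j, hj⟩ ≤ 1 :=
        (Finset.sum_le_sum_of_subset_of_nonneg
          (fun (i : Fin I.n) hi => hσS i ⟨b, hb⟩ (Finset.mem_filter.1 hi).2)
          fun i _ _ => I.w_nonneg i _).trans (hS ⟨b, hb⟩ ⟨j, hj⟩)
      have h3 : ((∑ i ∈ Finset.range I.n with σ i = b + 1, I.amt i j : ℕ) : ℚ) =
          I.den * ∑ i ∈ T, I.w i ⟨j, hj⟩ := by
        rw [Finset.sum_filter, ← Fin.sum_univ_eq_sum_range
          (fun i => if σ i = b + 1 then I.amt i j else 0), ← Finset.sum_filter, Nat.cast_sum,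
          Finset.mul_sum]
        exact Finset.sum_congr rfl fun i _ => cast_amt_w i ⟨j, hj⟩
      rw [h3]
      exact mul_le_of_le_one_right hd.le h2
    exact_mod_cast h1
  have hmain : (K : ℚ) * ((∑ i ∈ Finset.range I.n with σ i ≠ 0, I.amt i 2 : ℕ) : ℚ) ≤
      K * (I.value (I.answer K) : ℚ) +
        2 * I.m * ((∑ i ∈ Finset.range I.n with σ i ≠ 0, I.amt i 2 : ℕ) : ℚ) := by
    exact_mod_cast hmain
  rw [hP, cast_value] at hmain
  refine le_of_mul_le_mul_left ?_ hd
  linarith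

theorem opt_nonneg : 0 ≤ I.opt := by
  classical
  refine le_trans ?_ (Finset.le_sup' I.profit
    (Finset.mem_filter.2 ⟨Finset.mem_univ (fun _ => ∅), by simp [IsSolution]⟩))
  exact Finset.sum_nonneg fun i _ => I.p_nonneg i

/-! ### The encoded solution as a string of bits -/

theorem flatMap_finRange (n m : ℕ) (g : ℕ → ℕ → ℕ) :
    ((List.finRange m).flatMap fun b : Fin m => (List.finRange n).map fun i : Fin n => g b i) =
      (List.range (m * n)).map fun p => g (p / n) (p % n) := by
  have h : ∀ b : ℕ, (List.finRange n).map (fun i : Fin n => g b i) = (List.range n).map (g b) := by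
    intro b
    rw [← List.map_coe_finRange_eq_range, List.map_map]
    rfl
  simp only [h]
  induction m with
  | zero => simp
  | succ m ih =>
    rw [List.finRange_succ_last, List.flatMap_append, List.flatMap_map, Nat.succ_mul,
      List.range_add, List.map_append, List.map_map, List.flatMap_singleton]
    refine congrArg₂ _ ih (List.map_congr_left fun i hi => ?_)
    have hi := List.mem_range.1 hi
    simp only [Function.comp, Fin.val_last]
    rw [mul_comm, Nat.mul_add_div (by omega), Nat.div_eq_of_lt hi, Nat.mul_add_mod,
      Nat.mod_eq_of_lt hi, add_zero]

theorem encodeBins_decode (K : ℕ) :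
    I.encodeBins (I.decode (I.answer K)) =
      (List.range (I.m * I.n)).map fun p => I.outWord K / 2 ^ p % 2 := by
  have h := flatMap_finRange I.n I.m
    fun b i => if dig (I.answer K) (I.m + 1) i = b + 1 then 1 else 0
  simp only [encodeBins, decode, Finset.mem_filter, Finset.mem_univ, true_and]
  rw [h]
  refine List.map_congr_left fun p hp => ?_
  exact (dig_sum (b := 2) (fun p => if dig (I.answer K) (I.m + 1) (p % I.n) = p / I.n + 1
    then 1 else 0) _ (fun p _ => by split_ifs <;> norm_num) (List.mem_range.1 hp)).symm

end

/-! ### Assembling the scheme -/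

theorem exists_approxAlgorithm (M : ℕ) (ε : ℝ) (hε : 0 < ε) :
    ∃ P, IsApproxAlgorithm {I : VMK | I.m ≤ M} (1 - ε) P := by
  -- The relative loss is 2m/K, which this choice makes at most ε.
  obtain ⟨K, hK⟩ := exists_nat_gt (2 * M / ε)
  have hK0 : 0 < K := by
    have : (0 : ℝ) < K := lt_of_le_of_lt (by positivity) hK
    exact_mod_cast this
  obtain ⟨P, q, hP⟩ := exists_program (ι := {I : VMK // I.m ≤ M}) (pt_outWord K)
    (pt_m.mul pt_n) (pb_m.mul pb_n)
  refine ⟨P, q, fun I hI => ⟨I.decode (I.answer K), isSolution_decode feas_answer, ?_, ?_⟩⟩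
  · have h1 : (K : ℝ) * I.opt ≤ K * I.profit (I.decode (I.answer K)) + 2 * I.m * I.opt := by
      exact_mod_cast near_opt (I := I) hK0
    have h2 : (0 : ℝ) ≤ I.opt := by exact_mod_cast I.opt_nonneg
    have h3 : (I.m : ℝ) ≤ M := by exact_mod_cast hI
    have h4 : 2 * (M : ℝ) ≤ K * ε := ((div_lt_iff₀ hε).1 hK).le
    have h5 : 2 * (I.m : ℝ) * I.opt ≤ K * ε * I.opt :=
      mul_le_mul_of_nonneg_right (by linarith) h2
    have h6 : (0 : ℝ) < K := by exact_mod_cast hK0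
    refine le_of_mul_le_mul_left ?_ h6
    linarith
  · rw [encodeBins_decode]
    exact hP ⟨I, hI⟩

end VMK

theorem mainTheorem5 (M : ℕ) (hM : 0 < M) :
    VMK.AdmitsPTAS {I : VMK | I.m ≤ M} := by
  -- `choose!` needs a default program for the values ε ≤ 0.
  have : Nonempty RAM.Program := ⟨.skip⟩
  choose! A hA using VMK.exists_approxAlgorithm M
  exact ⟨A, hA⟩
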